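/- Let $(\Omega,P)$ be a standard Borel probability space, $Y$ an integrable real random variable, and $W,Z,U,A,X$ random variables with values in standard Borel spaces (for one generic unit: outcome $Y$, treatment $A$, covariates $X$, latent confounder $U$, negative control outcome $W$, negative control exposure $Z$). Write $F(\cdot\mid\cdot)$ for regular conditional distributions and $E(\cdot\mid\cdot)$ for the corresponding means. "For almost all $(a,x)$" refers to the law of $(A,X)$. Assume: (1) Negative control exposure: $Z\perp\!\!\!\perp Y\mid A,U,X$ and $Z\perp\!\!\!\perp W\mid A,U,X$. (2) Completeness of $W$ for $U$: for almost all $(a,x)$ and every $f\in L^2\{F(u\mid a,x)\}$, if $E\{f(U)\mid W=w,A=a,X=x\}=0$ for $F(w\mid a,x)$-almost all $w$, then $f(u)=0$ for $F(u\mid a,x)$-almost all $u$. (3) Regularity: for almost all $(a,x)$, - $F(dw,dz\mid a,x)$ has a density $\widetilde K_{a,x}(w,z)=\dfrac{dF(w,z\mid a,x)}{dF(w\mid a,x)\,dF(z\mid a,x)}$ with respect to $F(dw\mid a,x)\otimes F(dz\mid a,x)$, and $\iint \widetilde K_{a,x}(w,z)^2\,dF(w\mid a,x)\,dF(z\mid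 a,x)<\infty$ (equivalently, $\iint dF(z\mid w,a,x)\,dF(w\mid z,a,x)\,dw\,dz<\infty$); - $\int E(Y\mid a,z,x)^2\,dF(z\mid a,x)<\infty$; - $\sum_p \nu_p^{-2}\,|\langle E(Y\mid a,\cdot,x),\kappa_p\rangle|^2<\infty$, where $(\nu_p,\upsilon_p,\kappa_p)_p$ is a singular system of the operator $L^2\{F(w\mid a,x)\}\to L^2\{F(z\mid a,x)\}$, $h\mapsto E\{h(W)\mid Z=\cdot,A=a,X=x\}$ ($\nu_p>0$ the nonzero singular values with multiplicity, $\upsilon_p,\kappa_p$ orthonormal singular vectors), and the inner product is that of $L^2\{F(z\mid a,x)\}$; - $\int E(Y\mid a,u,x)^2\,dF(u\mid a,x)<\infty$. Then there is a measurable function $h^\dagger(w,a,x)$ with $h^\dagger(\cdot,a,x)\in L^2\{F(w\mid a,x)\}$ for almost all $(a,x)$, such that for almost all $(z,a,x)$ with respect to the law of $(Z,A,X)$, $h^\dagger(\cdot,a,x)$ is $F(w\mid z,a,x)$-integrable and $$E(Y\mid Z=z,A=a,X=x)=\int h^\dagger(w,a,x)\,dF(w\mid z,a,x)=E\{h^\dagger(W,a,x)\mid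 Z=z,A=a,X=x\}.$$ -/

import Mathlib

open MeasureTheory ProbabilityTheory Filter
open scoped ENNReal InnerProductSpace

noncomputable section

/-- `E(Y ∣ C = c)`: the mean of the regular conditional distribution of `Y` given `C = c`. -/
def condMean {Ω γ : Type*} [MeasurableSpace Ω] [MeasurableSpace γ]
    (P : Measure Ω) [IsFiniteMeasure P] (Y : Ω → ℝ) (C : Ω → γ) (c : γ) : ℝ :=
  ∫ y, y ∂(condDistrib Y C P c)

/-- Let `μ` be the joint law of a pair `(W, Z)`. This is the operator
`h ↦ E{h(W) ∣ Z = ·}` from `L²` of the law of `W` to `L²` of the law of `Z`, obtained by viewing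
`h(W)` as an element of `L²(μ)` and projecting it orthogonally to the functions of `Z`. -/
def condExpOp {𝒲 𝒵 : Type*} [MeasurableSpace 𝒲] [MeasurableSpace 𝒵] (μ : Measure (𝒲 × 𝒵)) :
    Lp ℝ 2 μ.fst →L[ℝ] Lp ℝ 2 μ.snd :=
  (ContinuousLinearMap.adjoint
    (Lp.compMeasurePreservingₗᵢ ℝ (E := ℝ) (p := 2) (Prod.snd : 𝒲 × 𝒵 → 𝒵)
      (⟨measurable_snd, rfl⟩ : MeasurePreserving Prod.snd μ μ.snd)).toContinuousLinearMap) ∘L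
    (Lp.compMeasurePreservingₗᵢ ℝ (E := ℝ) (p := 2) (Prod.fst : 𝒲 × 𝒵 → 𝒲)
      (⟨measurable_fst, rfl⟩ : MeasurePreserving Prod.fst μ μ.fst)).toContinuousLinearMap

/-- The defining property of the conditional expectation: `E[E{h(W) ∣ Z} g(Z)] = E[h(W) g(Z)]`
for all `g ∈ L²`. -/
theorem integral_condExpOp_mul {𝒲 𝒵 : Type*} [MeasurableSpace 𝒲] [MeasurableSpace 𝒵]
    (μ : Measure (𝒲 × 𝒵)) (h : Lp ℝ 2 μ.fst) (g : Lp ℝ 2 μ.snd) :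
    ∫ z, condExpOp μ h z * g z ∂μ.snd = ∫ q, h q.1 * g q.2 ∂μ := by
  have h1 : ⟪g, condExpOp μ h⟫_ℝ = ∫ z, condExpOp μ h z * g z ∂μ.snd := by
    simp [L2.inner_def]
  rw [← h1, condExpOp, ContinuousLinearMap.comp_apply, ContinuousLinearMap.adjoint_inner_right,
    L2.inner_def]
  refine integral_congr_ae ?_
  have e1 := Lp.coeFn_compMeasurePreserving h
    (⟨measurable_fst, rfl⟩ : MeasurePreserving Prod.fst μ μ.fst)
  have e2 := Lp.coeFn_compMeasurePreserving g
    (⟨measurable_snd, rfl⟩ : MeasurePreserving Prod.snd μ μ.snd)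
  filter_upwards [e1, e2] with q hq1 hq2
  have hq1' : (Lp.compMeasurePreserving Prod.fst
    (⟨measurable_fst, rfl⟩ : MeasurePreserving Prod.fst μ μ.fst) h) q = h q.1 := hq1
  have hq2' : (Lp.compMeasurePreserving Prod.snd
    (⟨measurable_snd, rfl⟩ : MeasurePreserving Prod.snd μ μ.snd) g) q = g q.2 := hq2
  change ⟪(Lp.compMeasurePreserving Prod.snd
      (⟨measurable_snd, rfl⟩ : MeasurePreserving Prod.snd μ μ.snd) g) q,
    (Lp.compMeasurePreserving Prod.fst
      (⟨measurable_fst, rfl⟩ : MeasurePreserving Prod.fst μ μ.fst) h) q⟫_ℝ = _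
  rw [hq1', hq2']
  simp

/-- `(ν, υ, κ)` is a singular system of the bounded operator `K` between real Hilbert spaces:
the `ν p > 0` are the nonzero singular values of `K`, repeated according to multiplicity, with
orthonormal singular vectors `υ p` and `κ p`, and `K` vanishes on the orthogonal complement of
the `υ p`. The index type is arbitrary (finite if `K` has finite rank). -/
structure IsSingularSystem {H₁ H₂ : Type*}
    [NormedAddCommGroup H₁] [InnerProductSpace ℝ H₁] [CompleteSpace H₁]
    [NormedAddCommGroup H₂] [InnerProductSpace ℝ H₂] [CompleteSpace H₂]
    (K : H₁ →L[ℝ] H₂) {ι : Type} (ν : ι → ℝ) (υ : ι → H₁) (κ : ι → H₂) : Prop where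
  pos : ∀ p, 0 < ν p
  orthonormal_left : Orthonormal ℝ υ
  orthonormal_right : Orthonormal ℝ κ
  map_eq : ∀ p, K (υ p) = ν p • κ p
  adjoint_eq : ∀ p, ContinuousLinearMap.adjoint K (κ p) = ν p • υ p
  complete : ∀ f : H₁, (∀ p, ⟪υ p, f⟫_ℝ = 0) → K f = 0

section

variable {Ω 𝒲 𝒵 𝒰 𝒜 𝒳 : Type*} [MeasurableSpace Ω] [MeasurableSpace 𝒲] [MeasurableSpace 𝒵]
  [MeasurableSpace 𝒰] [MeasurableSpace 𝒜] [MeasurableSpace 𝒳]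

/-- Relevance of `W` for `U` (completeness) at `(A, X) = (a, x)`: a function `f` that is square
integrable for `F(u ∣ a, x)` and has `E{f(U) ∣ W = w, A = a, X = x} = 0` for almost all `w`
vanishes almost surely. -/
def RelevantAt [StandardBorelSpace 𝒲] [Nonempty 𝒲] [StandardBorelSpace 𝒰] [Nonempty 𝒰]
    (P : Measure Ω) [IsFiniteMeasure P] (W : Ω → 𝒲) (U : Ω → 𝒰) (A : Ω → 𝒜) (X : Ω → 𝒳)
    (a : 𝒜) (x : 𝒳) : Prop :=
  ∀ f : 𝒰 → ℝ, MemLp f 2 (condDistrib U (fun ω => (A ω, X ω)) P (a, x)) →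
    (∀ᵐ w ∂(condDistrib W (fun ω => (A ω, X ω)) P (a, x)),
      ∫ u, f u ∂(condDistrib U (fun ω => (W ω, A ω, X ω)) P (w, a, x)) = 0) →
    ∀ᵐ u ∂(condDistrib U (fun ω => (A ω, X ω)) P (a, x)), f u = 0

/-- `F(w, z ∣ a, x)`; its marginals are `F(w ∣ a, x)` and `F(z ∣ a, x)`. -/
def lawWZ [StandardBorelSpace 𝒲] [Nonempty 𝒲] [StandardBorelSpace 𝒵] [Nonempty 𝒵]
    (P : Measure Ω) [IsFiniteMeasure P] (W : Ω → 𝒲) (Z : Ω → 𝒵) (A : Ω → 𝒜) (X : Ω → 𝒳)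
    (a : 𝒜) (x : 𝒳) : Measure (𝒲 × 𝒵) :=
  condDistrib (fun ω => (W ω, Z ω)) (fun ω => (A ω, X ω)) P (a, x)

/-- The regularity conditions on the `W`–`Z` kernel and on `E(Y ∣ a, z, x)`, at
`(A, X) = (a, x)`. -/
structure RegularAt [StandardBorelSpace 𝒲] [Nonempty 𝒲] [StandardBorelSpace 𝒵] [Nonempty 𝒵]
    (P : Measure Ω) [IsFiniteMeasure P] (Y : Ω → ℝ) (W : Ω → 𝒲) (Z : Ω → 𝒵) (A : Ω → 𝒜)
    (X : Ω → 𝒳) (a : 𝒜) (x : 𝒳) : Prop where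
  /-- The kernel `dF(w, z ∣ a, x) / (dF(w ∣ a, x) dF(z ∣ a, x))` exists. -/
  absolutelyContinuous :
    lawWZ P W Z A X a x ≪ (lawWZ P W Z A X a x).fst.prod (lawWZ P W Z A X a x).snd
  /-- `∫∫ dF(z ∣ w, a, x) dF(w ∣ z, a, x) dw dz < ∞`, that is, the kernel is square integrable
  for `F(w ∣ a, x) ⊗ F(z ∣ a, x)`. -/
  kernel_sq : ∫⁻ q, ((lawWZ P W Z A X a x).rnDeriv
      ((lawWZ P W Z A X a x).fst.prod (lawWZ P W Z A X a x).snd) q) ^ 2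
      ∂((lawWZ P W Z A X a x).fst.prod (lawWZ P W Z A X a x).snd) < ∞
  /-- `∫ E(Y ∣ a, z, x)² dF(z ∣ a, x) < ∞`. -/
  mean_sq : MemLp (fun z => condMean P Y (fun ω => (Z ω, A ω, X ω)) (z, a, x)) 2
    (lawWZ P W Z A X a x).snd
  /-- `∑ₚ νₚ⁻² |⟨E(Y ∣ a, ·, x), κₚ⟩|² < ∞` for the singular system of the operator
  `h ↦ E{h(W) ∣ Z = ·, A = a, X = x}`. The sum does not depend on the choice of the system. -/
  picard : ∀ (ι : Type) (ν : ι → ℝ) (υ : ι → Lp ℝ 2 (lawWZ P W Z A X a x).fst)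
    (κ : ι → Lp ℝ 2 (lawWZ P W Z A X a x).snd),
    IsSingularSystem (condExpOp (lawWZ P W Z A X a x)) ν υ κ →
    Summable fun p => 1 / (ν p) ^ 2 *
      |∫ z, condMean P Y (fun ω => (Z ω, A ω, X ω)) (z, a, x) * κ p z
        ∂(lawWZ P W Z A X a x).snd| ^ 2

end

end

/-!
Fix `(a, x)` and let `K` be the operator `h ↦ E{h(W) ∣ Z = ·, A = a, X = x}`. Its kernel is square
integrable, so `K` is Hilbert–Schmidt and has a singular system. If `K† g = 0`, then conditional
independence gives `E[E{g(Z) ∣ U} ∣ W] = 0`, so `E{g(Z) ∣ U} = 0` by completeness, and `g` is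
orthogonal to `E(Y ∣ a, ·, x) = E{E(Y ∣ a, U, x) ∣ Z = ·}`. Picard's criterion then solves
`K h = E(Y ∣ a, ·, x)`.

These solutions have to be chosen measurably in `(a, x)`. Solvability at `(a, x)` is equivalent to a
bound `⟨E(Y ∣ a, ·, x), g⟩² ≤ D(a, x) ‖K† g‖²`, and the least such `D` is an essential supremum of
measurable functions of `(a, x)`, so it can be taken measurable. Multiplying the equation by the
weight `v = (1 + D + ‖E(Y ∣ a, ·, x)‖²)⁻¹` makes this bound uniform, so that Douglas' range
criterion solves the weighted equation for all `(a, x)` at once in `L²` of the law of `(A, X, W)`.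
Dividing the solution by `v` gives `h†`.
-/

section HilbertSpace

variable {ι H₁ H₂ : Type*}
  [NormedAddCommGroup H₁] [InnerProductSpace ℝ H₁]
  [NormedAddCommGroup H₂] [InnerProductSpace ℝ H₂]

theorem isCompactOperator_rankOne (y : H₂) (x : H₁) :
    IsCompactOperator (InnerProductSpace.rankOne ℝ y x) := by
  have hid : IsCompactOperator (id : ℝ → ℝ) := by
    rw [isCompactOperator_id_iff_finiteDimensional (𝕜 := ℝ)]
    infer_instance
  exact (hid.comp_clm (innerSL ℝ x)).clm_comp ((ContinuousLinearMap.id ℝ ℝ).smulRight y)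

theorem norm_sum_rankOne_sq_le {e : ι → H₁} (he : Orthonormal ℝ e) (y : ι → H₂) (s : Finset ι) :
    ‖∑ i ∈ s, InnerProductSpace.rankOne ℝ (y i) (e i)‖ ^ 2 ≤ ∑ i ∈ s, ‖y i‖ ^ 2 := by
  have hnonneg : 0 ≤ ∑ i ∈ s, ‖y i‖ ^ 2 := by positivity
  refine Real.le_sqrt (norm_nonneg _) hnonneg |>.1 ?_
  refine ContinuousLinearMap.opNorm_le_bound _ (Real.sqrt_nonneg _) fun f => ?_
  refine abs_le_of_sq_le_sq' ?_ (by positivity) |>.2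
  calc ‖(∑ i ∈ s, InnerProductSpace.rankOne ℝ (y i) (e i)) f‖ ^ 2
      = ‖∑ i ∈ s, ⟪e i, f⟫_ℝ • y i‖ ^ 2 := by
        simp only [sum_apply, InnerProductSpace.rankOne_apply]
    _ ≤ (∑ i ∈ s, ‖⟪e i, f⟫_ℝ‖ * ‖y i‖) ^ 2 := by
        gcongr
        exact norm_sum_le_of_le _ fun i _ => norm_smul_le _ _
    _ ≤ (∑ i ∈ s, ‖⟪e i, f⟫_ℝ‖ ^ 2) * ∑ i ∈ s, ‖y i‖ ^ 2 := Finset.sum_mul_sq_le_sq_mul_sq _ _ _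
    _ ≤ ‖f‖ ^ 2 * ∑ i ∈ s, ‖y i‖ ^ 2 := by
        gcongr
        exact he.sum_inner_products_le f
    _ = (√(∑ i ∈ s, ‖y i‖ ^ 2) * ‖f‖) ^ 2 := by rw [mul_pow, Real.sq_sqrt hnonneg, mul_comm]

theorem summable_rankOne [CompleteSpace H₂] {e : ι → H₁} (he : Orthonormal ℝ e) {y : ι → H₂}
    (hy : Summable fun i => ‖y i‖ ^ 2) :
    Summable fun i => InnerProductSpace.rankOne ℝ (y i) (e i) := by
  rw [summable_iff_vanishing_norm] at hy ⊢
  intro ε hε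
  obtain ⟨s, hs⟩ := hy (ε ^ 2) (by positivity)
  refine ⟨s, fun t ht => abs_lt_of_sq_lt_sq' ?_ hε.le |>.2⟩
  exact (norm_sum_rankOne_sq_le he y t).trans_lt ((le_abs_self _).trans_lt (hs t ht))

/-- A Hilbert–Schmidt operator is the sum in operator norm of the rank one operators
`K (e i) ⊗ e i`. -/
theorem isCompactOperator_of_summable_norm_sq [CompleteSpace H₂] (e : HilbertBasis ι ℝ H₁)
    {K : H₁ →L[ℝ] H₂} (hK : Summable fun i => ‖K (e i)‖ ^ 2) : IsCompactOperator K := by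
  obtain ⟨T, hT⟩ := summable_rankOne e.orthonormal hK
  have hTK : T = K := by
    ext f
    have hTf : HasSum (fun i => ⟪e i, f⟫_ℝ • K (e i)) (T f) :=
      hT.mapL (ContinuousLinearMap.apply ℝ H₂ f)
    have hKf : HasSum (fun i => ⟪e i, f⟫_ℝ • K (e i)) (K f) := by
      simpa only [e.repr_apply_apply, map_smul] using (e.hasSum_repr f).mapL K
    exact hTf.unique hKf
  rw [← hTK]
  exact isCompactOperator_of_tendsto hT (Eventually.of_forall fun s =>
    (compactOperator (RingHom.id ℝ) H₁ H₂).sum_mem fun i _ => isCompactOperator_rankOne _ _)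

theorem sum_norm_sq_le_norm_sq_of_pairwise_inner_eq_zero {v : ι → H₁}
    (hv : Pairwise fun i j => ⟪v i, v j⟫_ℝ = 0) {k : H₁} (hk : ∀ i, ⟪v i, k⟫_ℝ = ‖v i‖ ^ 2)
    (s : Finset ι) : ∑ i ∈ s, ‖v i‖ ^ 2 ≤ ‖k‖ ^ 2 := by
  set S := ∑ i ∈ s, v i with hS_def
  have hSk : ⟪S, k⟫_ℝ = ∑ i ∈ s, ‖v i‖ ^ 2 := by simp only [hS_def, sum_inner, hk]
  have hSS : ‖S‖ ^ 2 = ∑ i ∈ s, ‖v i‖ ^ 2 := by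
    rw [← real_inner_self_eq_norm_sq, hS_def, sum_inner]
    refine Finset.sum_congr rfl fun i hi => ?_
    rw [inner_sum, Finset.sum_eq_single_of_mem i hi fun j _ hij => hv hij.symm,
      real_inner_self_eq_norm_sq]
  have hdist : ‖S - k‖ ^ 2 = ‖S‖ ^ 2 - 2 * ⟪S, k⟫_ℝ + ‖k‖ ^ 2 := norm_sub_sq_real S k
  nlinarith [sq_nonneg ‖S - k‖]

variable [CompleteSpace H₁]

theorem exists_orthonormal_eigenvectors {T : H₁ →L[ℝ] H₁} (hT : IsCompactOperator T)
    (hsymm : (T : H₁ →ₗ[ℝ] H₁).IsSymmetric) :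
    ∃ (ι : Type) (lam : ι → ℝ) (υ : ι → H₁), (∀ p, lam p ≠ 0) ∧ Orthonormal ℝ υ ∧
      (∀ p, T (υ p) = lam p • υ p) ∧ ∀ f, (∀ p, ⟪υ p, f⟫_ℝ = 0) → T f = 0 := by
  let E : ℝ → Submodule ℝ H₁ := Module.End.eigenspace (T : H₁ →ₗ[ℝ] H₁)
  have hfin : ∀ c : {c : ℝ // c ≠ 0}, FiniteDimensional ℝ (E c) := fun c =>
    ContinuousLinearMap.finite_dimensional_eigenspace hT c.1 c.2
  let b (c : {c : ℝ // c ≠ 0}) := stdOrthonormalBasis ℝ (E c)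
  refine ⟨Σ c : {c : ℝ // c ≠ 0}, Fin (Module.finrank ℝ (E c)), fun p => p.1,
    fun p => b p.1 p.2, fun p => p.1.2, ?_,
    fun p => Module.End.mem_eigenspace_iff.1 (b p.1 p.2).2, fun f hf => ?_⟩
  · exact (hsymm.orthogonalFamily_eigenspaces.comp
      Subtype.val_injective).orthonormal_sigma_orthonormal (v_family := fun c i => b c i)
        fun c => (b c).orthonormal
  have hperp : ∀ c ≠ 0, ∀ v ∈ E c, ⟪v, f⟫_ℝ = 0 := fun c hc v hv => by
    have hrepr := congrArg (fun w : E c => (w : H₁)) ((b ⟨c, hc⟩).sum_repr' ⟨v, hv⟩)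
    simp only [Submodule.coe_sum, Submodule.coe_smul] at hrepr
    rw [← hrepr, sum_inner]
    refine Finset.sum_eq_zero fun i _ => ?_
    rw [real_inner_smul_left, hf ⟨⟨c, hc⟩, i⟩, mul_zero]
  have hTperp : ∀ c, ∀ v ∈ E c, ⟪v, T f⟫_ℝ = 0 := fun c v hv => by
    have hTv : ⟪v, T f⟫_ℝ = c * ⟪v, f⟫_ℝ := by
      rw [← real_inner_smul_left, ← Module.End.mem_eigenspace_iff.1 hv]
      exact (hsymm v f).symm
    rcases eq_or_ne c 0 with rfl | hc
    · rw [hTv, zero_mul]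
    · rw [hTv, hperp c hc v hv, mul_zero]
  have hmem : T f ∈ (⨆ c, E c)ᗮ := by
    rw [← Submodule.iInf_orthogonal, Submodule.mem_iInf]
    exact fun c => (Submodule.mem_orthogonal _ _).2 (hTperp c)
  rwa [ContinuousLinearMap.orthogonalComplement_iSup_eigenspaces_eq_bot hT hsymm,
    Submodule.mem_bot] at hmem

variable [CompleteSpace H₂] {K : H₁ →L[ℝ] H₂}

theorem isSingularSystem_of_adjoint_apply_eq_smul {ι : Type} {lam : ι → ℝ} {υ : ι → H₁}
    (hlam : ∀ p, lam p ≠ 0) (hυ : Orthonormal ℝ υ)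
    (heig : ∀ p, ContinuousLinearMap.adjoint K (K (υ p)) = lam p • υ p)
    (hcompl : ∀ f, (∀ p, ⟪υ p, f⟫_ℝ = 0) → K f = 0) :
    IsSingularSystem K (fun p => √(lam p)) υ fun p => (√(lam p))⁻¹ • K (υ p) := by
  have hinner : ∀ p q, ⟪K (υ p), K (υ q)⟫_ℝ = lam p * ⟪υ p, υ q⟫_ℝ := fun p q => by
    rw [← ContinuousLinearMap.adjoint_inner_left, heig, real_inner_smul_left]
  have hpos : ∀ p, 0 < lam p := fun p => by
    refine lt_of_le_of_ne ?_ (hlam p).symm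
    have hself := hinner p p
    rw [real_inner_self_eq_norm_sq (υ p), hυ.1 p, one_pow, mul_one] at hself
    exact hself ▸ real_inner_self_nonneg
  have hsqrt : ∀ p, √(lam p) ≠ 0 := fun p => (Real.sqrt_pos.2 (hpos p)).ne'
  refine ⟨fun p => Real.sqrt_pos.2 (hpos p), hυ, ?_, fun p => ?_, fun p => ?_, hcompl⟩
  · classical
    rw [orthonormal_iff_ite]
    intro p q
    rw [real_inner_smul_left, real_inner_smul_right, hinner, orthonormal_iff_ite.1 hυ p q]
    split_ifs with hpq
    · subst hpq
      have := hsqrt p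
      field_simp
      exact (Real.sq_sqrt (hpos p).le).symm
    · rw [mul_zero, mul_zero, mul_zero]
  · exact (smul_inv_smul₀ (hsqrt p) _).symm
  · rw [map_smul, heig, smul_smul, inv_mul_eq_div, Real.div_sqrt]

theorem exists_isSingularSystem_of_isCompactOperator (hK : IsCompactOperator K) :
    ∃ (ι : Type) (ν : ι → ℝ) (υ : ι → H₁) (κ : ι → H₂), IsSingularSystem K ν υ κ := by
  have hsymm : ((ContinuousLinearMap.adjoint K ∘L K : H₁ →L[ℝ] H₁) : H₁ →ₗ[ℝ] H₁).IsSymmetric :=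
    ((ContinuousLinearMap.isPositive_adjoint_comp_self K).isSelfAdjoint).isSymmetric
  obtain ⟨ι, lam, υ, hlam, hυ, heig, hcompl⟩ :=
    exists_orthonormal_eigenvectors (hK.clm_comp (ContinuousLinearMap.adjoint K)) hsymm
  refine ⟨ι, _, υ, _, isSingularSystem_of_adjoint_apply_eq_smul hlam hυ heig fun f hf => ?_⟩
  rw [← inner_self_eq_zero (𝕜 := ℝ), ← ContinuousLinearMap.adjoint_inner_left]
  exact (congrArg (⟪·, f⟫_ℝ) (hcompl f hf)).trans (inner_zero_left f)

namespace IsSingularSystem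

variable {ι : Type} {ν : ι → ℝ} {υ : ι → H₁} {κ : ι → H₂}

theorem adjoint_apply_eq_zero (hS : IsSingularSystem K ν υ κ) {g : H₂}
    (hg : ∀ p, ⟪κ p, g⟫_ℝ = 0) : ContinuousLinearMap.adjoint K g = 0 := by
  have hKK : K (ContinuousLinearMap.adjoint K g) = 0 := hS.complete _ fun p => by
    rw [ContinuousLinearMap.adjoint_inner_right, hS.map_eq, real_inner_smul_left, hg, mul_zero]
  rw [← inner_self_eq_zero (𝕜 := ℝ), ContinuousLinearMap.adjoint_inner_left, hKK,
    inner_zero_right]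

/-- Picard's criterion: the solution is `∑ (ν p)⁻¹ ⟪m, κ p⟫ υ p`, whose image differs from `m` by
an element of the kernel of the adjoint. -/
theorem exists_apply_eq (hS : IsSingularSystem K ν υ κ) {m : H₂}
    (hm : ∀ g, ContinuousLinearMap.adjoint K g = 0 → ⟪m, g⟫_ℝ = 0)
    (hsum : Summable fun p => 1 / (ν p) ^ 2 * |⟪m, κ p⟫_ℝ| ^ 2) : ∃ h, K h = m := by
  let a : ι → ℝ := fun p => (ν p)⁻¹ * ⟪m, κ p⟫_ℝ
  have ha : Summable fun p => a p • υ p := by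
    refine (hS.orthonormal_left.orthogonalFamily.summable_iff_norm_sq_summable a).2 ?_
    refine hsum.congr fun p => ?_
    rw [Real.norm_eq_abs, abs_mul, mul_pow, sq_abs (ν p)⁻¹, inv_pow, one_div]
  obtain ⟨h, hh⟩ := ha
  have hcoef : ∀ p, ⟪υ p, h⟫_ℝ = a p := fun p => by
    refine (hh.mapL (innerSL ℝ (υ p))).unique ?_
    convert hasSum_single p fun q hq => ?_ using 1
    · simp [hS.orthonormal_left.1 p]
    · simp [hS.orthonormal_left.2 hq.symm]
  have hperp : ∀ p, ⟪κ p, m - K h⟫_ℝ = 0 := fun p => by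
    rw [inner_sub_right, ← ContinuousLinearMap.adjoint_inner_left, hS.adjoint_eq,
      real_inner_smul_left, hcoef, mul_inv_cancel_left₀ (hS.pos p).ne', real_inner_comm, sub_self]
  have hker := hS.adjoint_apply_eq_zero hperp
  have hself : ⟪m - K h, m - K h⟫_ℝ = 0 := by
    rw [inner_sub_left, hm _ hker, ← ContinuousLinearMap.adjoint_inner_right, hker,
      inner_zero_right, sub_zero]
  exact ⟨h, (sub_eq_zero.1 (inner_self_eq_zero.1 hself)).symm⟩

end IsSingularSystem

/-- Douglas' range criterion: `K† g ↦ ⟪m, g⟫` extends to `H₁` by Hahn–Banach. -/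
theorem exists_apply_eq_of_abs_inner_le {m : H₂} {C : ℝ}
    (hm : ∀ g, |⟪m, g⟫_ℝ| ≤ C * ‖ContinuousLinearMap.adjoint K g‖) : ∃ h, K h = m := by
  let T : H₂ →ₗ[ℝ] H₁ := ContinuousLinearMap.adjoint K
  obtain ⟨s, hs⟩ := T.rangeRestrict.exists_rightInverse_of_surjective T.range_rangeRestrict
  have hTs : ∀ y : LinearMap.range T, T (s y) = y := fun y =>
    congrArg Subtype.val (LinearMap.congr_fun hs y)
  let φ : StrongDual ℝ (LinearMap.range T) :=
    LinearMap.mkContinuous ((innerSL ℝ m : H₂ →ₗ[ℝ] ℝ) ∘ₗ s) C fun y =>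
      (hm (s y)).trans_eq (congrArg (fun v : H₁ => C * ‖v‖) (hTs y))
  obtain ⟨ψ, hψ, -⟩ := exists_extension_norm_eq (LinearMap.range T) φ
  refine ⟨(InnerProductSpace.toDual ℝ H₁).symm ψ, ext_inner_right ℝ fun g => ?_⟩
  have hψg : ψ (T g) = ⟪m, s (T.rangeRestrict g)⟫_ℝ := hψ (T.rangeRestrict g)
  have hsg : T (s (T.rangeRestrict g) - g) = 0 := by
    rw [map_sub, hTs]
    exact sub_self _
  have hms : ⟪m, s (T.rangeRestrict g) - g⟫_ℝ = 0 := by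
    rw [← abs_nonpos_iff]
    exact (hm _).trans_eq (by rw [show ContinuousLinearMap.adjoint K _ = 0 from hsg, norm_zero,
      mul_zero])
  rw [inner_sub_right, sub_eq_zero] at hms
  rw [← ContinuousLinearMap.adjoint_inner_right, InnerProductSpace.toDual_symm_apply]
  exact hψg.trans hms

end HilbertSpace

section SquareIntegrable

variable {α β : Type*} [MeasurableSpace α] [MeasurableSpace β] {μ : Measure α} {ν : Measure β}

theorem integral_comp_of_measurePreserving {T : α → β} (hT : MeasurePreserving T μ ν) {f : β → ℝ}
    (hf : AEStronglyMeasurable f ν) : ∫ x, f (T x) ∂μ = ∫ y, f y ∂ν := by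
  rw [← hT.map_eq] at hf ⊢
  exact (integral_map hT.measurable.aemeasurable hf).symm

theorem inner_Lp_eq_integral (f g : Lp ℝ 2 μ) : ⟪f, g⟫_ℝ = ∫ x, f x * g x ∂μ := by
  rw [L2.inner_def]
  exact integral_congr_ae (Eventually.of_forall fun x => mul_comm (g x) (f x))

theorem inner_toLp_right (f : Lp ℝ 2 μ) {g : α → ℝ} (hg : MemLp g 2 μ) :
    ⟪f, hg.toLp g⟫_ℝ = ∫ x, f x * g x ∂μ := by
  rw [inner_Lp_eq_integral]
  refine integral_congr_ae ?_
  filter_upwards [hg.coeFn_toLp] with x hx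
  rw [hx]

theorem inner_toLp_toLp {f g : α → ℝ} (hf : MemLp f 2 μ) (hg : MemLp g 2 μ) :
    ⟪hf.toLp f, hg.toLp g⟫_ℝ = ∫ x, f x * g x ∂μ := by
  rw [inner_toLp_right]
  refine integral_congr_ae ?_
  filter_upwards [hf.coeFn_toLp] with x hx
  rw [hx]

theorem norm_Lp_sq_eq_integral (f : Lp ℝ 2 μ) : ‖f‖ ^ 2 = ∫ x, f x ^ 2 ∂μ := by
  rw [← real_inner_self_eq_norm_sq, inner_Lp_eq_integral]
  simp only [sq]

theorem sq_integral_le_mul_integral_sq [IsFiniteMeasure μ] {f : α → ℝ} (hf : MemLp f 2 μ) :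
    (∫ x, f x ∂μ) ^ 2 ≤ μ.real Set.univ * ∫ x, f x ^ 2 ∂μ := by
  have h := real_inner_mul_inner_self_le (hf.toLp f) ((memLp_const (1 : ℝ)).toLp _)
  simpa only [inner_toLp_toLp, mul_one, integral_const, smul_eq_mul, ← sq, one_pow, one_mul,
    mul_comm] using h

theorem memLp_mul_prod {f : α → ℝ} {g : β → ℝ} (hf : MemLp f 2 μ)
    (hg : MemLp g 2 ν) : MemLp (fun q : α × β => f q.1 * g q.2) 2 (μ.prod ν) := by
  refine (memLp_two_iff_integrable_sq (hf.1.comp_fst.mul hg.1.comp_snd)).2 ?_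
  simpa only [Pi.mul_apply, mul_pow] using hf.integrable_sq.mul_prod hg.integrable_sq

/-- `K` is Hilbert–Schmidt: for an orthonormal basis `e`, the functions `e i ⊗ K (e i)` are
orthogonal and their inner products with the kernel are the squared norms `‖K (e i)‖ ^ 2`. -/
theorem isCompactOperator_of_inner_eq_integral [SFinite μ] [SFinite ν]
    {K : Lp ℝ 2 μ →L[ℝ] Lp ℝ 2 ν} {k : α × β → ℝ} (hk : MemLp k 2 (μ.prod ν))
    (hK : ∀ f g, ⟪K f, g⟫_ℝ = ∫ q, k q * (f q.1 * g q.2) ∂(μ.prod ν)) :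
    IsCompactOperator K := by
  obtain ⟨w, e, -⟩ := exists_hilbertBasis ℝ (Lp ℝ 2 μ)
  have htensor (i : w) : MemLp (fun q : α × β => e i q.1 * K (e i) q.2) 2 (μ.prod ν) :=
    memLp_mul_prod (Lp.memLp (e i)) (Lp.memLp (K (e i)))
  let v (i : w) : Lp ℝ 2 (μ.prod ν) := (htensor i).toLp _
  have hvv : ∀ i j, ⟪v i, v j⟫_ℝ = ⟪e i, e j⟫_ℝ * ⟪K (e i), K (e j)⟫_ℝ := fun i j => by
    rw [inner_toLp_toLp, inner_Lp_eq_integral, inner_Lp_eq_integral, ← integral_prod_mul]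
    refine integral_congr_ae (Eventually.of_forall fun q => ?_)
    exact mul_mul_mul_comm (e i q.1) (K (e i) q.2) (e j q.1) (K (e j) q.2)
  have hvnorm : ∀ i, ‖v i‖ ^ 2 = ‖K (e i)‖ ^ 2 := fun i => by
    rw [← real_inner_self_eq_norm_sq, hvv, real_inner_self_eq_norm_sq, real_inner_self_eq_norm_sq,
      e.orthonormal.1 i, one_pow, one_mul]
  have hvk : ∀ i, ⟪v i, hk.toLp k⟫_ℝ = ‖v i‖ ^ 2 := fun i => by
    rw [hvnorm, ← real_inner_self_eq_norm_sq, hK, real_inner_comm, inner_toLp_toLp]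
  have horth : Pairwise fun i j => ⟪v i, v j⟫_ℝ = 0 := fun i j hij =>
    (hvv i j).trans (by rw [e.orthonormal.2 hij, zero_mul])
  refine isCompactOperator_of_summable_norm_sq e
    (summable_of_sum_le (c := ‖hk.toLp k‖ ^ 2) (fun i => sq_nonneg _) fun s => ?_)
  simpa only [hvnorm] using sum_norm_sq_le_norm_sq_of_pairwise_inner_eq_zero horth hvk s

theorem ae_memLp_of_memLp_compProd [SFinite μ] {κ : Kernel α β} [IsSFiniteKernel κ]
    {G : α × β → ℝ} (hG : MemLp G 2 (μ ⊗ₘ κ)) : ∀ᵐ a ∂μ, MemLp (fun b => G (a, b)) 2 (κ a) := by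
  filter_upwards [((Measure.integrable_compProd_iff hG.integrable_sq.1).1 hG.integrable_sq).1,
    AEStronglyMeasurable.ae_of_compProd (f := fun a b => G (a, b)) hG.1] with a hsq hmeas
  exact (memLp_two_iff_integrable_sq hmeas).2 hsq

theorem memLp_integral_compProd [SFinite μ] {κ : Kernel α β} [IsMarkovKernel κ] {G : α × β → ℝ}
    (hG : MemLp G 2 (μ ⊗ₘ κ)) : MemLp (fun a => ∫ b, G (a, b) ∂κ a) 2 μ := by
  have hmeas : AEStronglyMeasurable (fun a => ∫ b, G (a, b) ∂κ a) μ := by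
    refine ⟨_, hG.1.stronglyMeasurable_mk.integral_kernel_prod_right' (κ := κ), ?_⟩
    filter_upwards [Measure.ae_ae_of_ae_compProd hG.1.ae_eq_mk] with a ha
    exact integral_congr_ae ha
  refine (memLp_two_iff_integrable_sq hmeas).2 ?_
  refine ((Measure.integrable_compProd_iff hG.integrable_sq.1).1 hG.integrable_sq).2.mono'
    (hmeas.pow 2) ?_
  filter_upwards [ae_memLp_of_memLp_compProd hG] with a ha
  simpa only [norm_pow, Real.norm_eq_abs, sq_abs, probReal_univ, one_mul] using
    sq_integral_le_mul_integral_sq ha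

end SquareIntegrable

section CondExpOp

variable {Ω 𝒮 𝒯 𝒱 𝒲 𝒵 : Type*} [MeasurableSpace Ω] [MeasurableSpace 𝒮] [MeasurableSpace 𝒯]
  [MeasurableSpace 𝒱] [MeasurableSpace 𝒲] [MeasurableSpace 𝒵] {P : Measure Ω} {μ : Measure 𝒯}
  {ν : Measure 𝒱} {S : Ω → 𝒮} {T : Ω → 𝒯} {V : Ω → 𝒱}

/-- The conditional expectation `f ↦ E{f(T) ∣ V = ·}` from `L²` of the law of `T` to `L²` of the
law of `V`, where `T` and `V` are defined on a common measure space. It extends `condExpOp`, in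
which `T` and `V` are the two coordinates, so that the roles of `T` and `V` can be exchanged. -/
noncomputable def l2CondExp (hT : MeasurePreserving T P μ) (hV : MeasurePreserving V P ν) :
    Lp ℝ 2 μ →L[ℝ] Lp ℝ 2 ν :=
  (ContinuousLinearMap.adjoint
    (Lp.compMeasurePreservingₗᵢ ℝ (E := ℝ) (p := 2) V hV).toContinuousLinearMap) ∘L
    (Lp.compMeasurePreservingₗᵢ ℝ (E := ℝ) (p := 2) T hT).toContinuousLinearMap

theorem condExpOp_eq_l2CondExp (μ : Measure (𝒲 × 𝒵)) :
    condExpOp μ = l2CondExp (P := μ) (μ := μ.fst) (ν := μ.snd)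
      ⟨measurable_fst, rfl⟩ ⟨measurable_snd, rfl⟩ :=
  rfl

theorem adjoint_l2CondExp (hT : MeasurePreserving T P μ) (hV : MeasurePreserving V P ν) :
    ContinuousLinearMap.adjoint (l2CondExp hT hV) = l2CondExp hV hT := by
  rw [l2CondExp, ContinuousLinearMap.adjoint_comp, ContinuousLinearMap.adjoint_adjoint, l2CondExp]

theorem inner_l2CondExp (hT : MeasurePreserving T P μ) (hV : MeasurePreserving V P ν)
    (f : Lp ℝ 2 μ) (g : Lp ℝ 2 ν) : ⟪l2CondExp hT hV f, g⟫_ℝ = ∫ ω, f (T ω) * g (V ω) ∂P := by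
  rw [l2CondExp, ContinuousLinearMap.comp_apply, ContinuousLinearMap.adjoint_inner_left]
  refine (inner_Lp_eq_integral _ _).trans (integral_congr_ae ?_)
  filter_upwards [Lp.coeFn_compMeasurePreserving f hT, Lp.coeFn_compMeasurePreserving g hV]
    with ω hf hg
  exact congrArg₂ (· * ·) hf hg

theorem l2CondExp_ae_eq [SFinite ν] {η : Kernel 𝒱 𝒮} [IsMarkovKernel η]
    (hVS : MeasurePreserving (fun ω => (V ω, S ω)) P (ν ⊗ₘ η)) {ψ : 𝒱 × 𝒮 → 𝒯} (hψ : Measurable ψ)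
    (hT : MeasurePreserving (fun ω => ψ (V ω, S ω)) P μ) (hV : MeasurePreserving V P ν)
    (f : Lp ℝ 2 μ) : l2CondExp hT hV f =ᵐ[ν] fun v => ∫ s, f (ψ (v, s)) ∂η v := by
  have hψ' : MeasurePreserving ψ (ν ⊗ₘ η) μ := by
    refine ⟨hψ, ?_⟩
    rw [← hVS.map_eq, Measure.map_map hψ hVS.measurable]
    exact hT.map_eq
  have hfst : MeasurePreserving Prod.fst (ν ⊗ₘ η) ν := ⟨measurable_fst, Measure.fst_compProd ν η⟩
  have hG : MemLp (fun q => f (ψ q)) 2 (ν ⊗ₘ η) := (Lp.memLp f).comp_measurePreserving hψ'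
  have hF : MemLp (fun v => ∫ s, f (ψ (v, s)) ∂η v) 2 ν := memLp_integral_compProd hG
  suffices l2CondExp hT hV f = hF.toLp _ by
    rw [this]
    exact hF.coeFn_toLp
  refine ext_inner_right ℝ fun g => ?_
  have hGg : Integrable (fun q : 𝒱 × 𝒮 => f (ψ q) * g q.1) (ν ⊗ₘ η) :=
    hG.integrable_mul ((Lp.memLp g).comp_measurePreserving hfst)
  calc ⟪l2CondExp hT hV f, g⟫_ℝ
      = ∫ ω, f (ψ (V ω, S ω)) * g (V ω) ∂P := inner_l2CondExp hT hV f g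
    _ = ∫ q, f (ψ q) * g q.1 ∂(ν ⊗ₘ η) := integral_comp_of_measurePreserving hVS hGg.1
    _ = ∫ v, (∫ s, f (ψ (v, s)) ∂η v) * g v ∂ν := by
        simp only [Measure.integral_compProd hGg, integral_mul_const]
    _ = ⟪hF.toLp _, g⟫_ℝ := by
        rw [real_inner_comm, inner_toLp_right]
        simp only [mul_comm]

theorem inner_condExpOp (μ : Measure (𝒲 × 𝒵)) (f : Lp ℝ 2 μ.fst) (g : Lp ℝ 2 μ.snd) :
    ⟪condExpOp μ f, g⟫_ℝ = ∫ q, f q.1 * g q.2 ∂μ := by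
  rw [inner_Lp_eq_integral, integral_condExpOp_mul]

theorem adjoint_condExpOp_ae_eq {μ : Measure (𝒲 × 𝒵)} [SFinite μ] {θ : Kernel 𝒲 𝒵}
    [IsMarkovKernel θ] (hθ : μ = μ.fst ⊗ₘ θ) (g : Lp ℝ 2 μ.snd) :
    ContinuousLinearMap.adjoint (condExpOp μ) g =ᵐ[μ.fst] fun w => ∫ z, g z ∂θ w := by
  rw [condExpOp_eq_l2CondExp, adjoint_l2CondExp]
  exact l2CondExp_ae_eq (V := Prod.fst) (S := Prod.snd) (ψ := Prod.snd)
    ⟨measurable_id, Measure.map_id.trans hθ⟩ measurable_snd _ _ g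

theorem isCompactOperator_condExpOp (μ : Measure (𝒲 × 𝒵)) [IsFiniteMeasure μ]
    (hac : μ ≪ μ.fst.prod μ.snd)
    (hsq : ∫⁻ q, (μ.rnDeriv (μ.fst.prod μ.snd) q) ^ 2 ∂(μ.fst.prod μ.snd) < ∞) :
    IsCompactOperator (condExpOp μ) := by
  let k : 𝒲 × 𝒵 → ℝ := fun q => (μ.rnDeriv (μ.fst.prod μ.snd) q).toReal
  have hk : MemLp k 2 (μ.fst.prod μ.snd) := by
    refine ⟨(Measure.measurable_rnDeriv _ _).ennreal_toReal.aestronglyMeasurable, ?_⟩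
    rw [eLpNorm_lt_top_iff_lintegral_rpow_enorm_lt_top two_ne_zero ENNReal.ofNat_ne_top]
    refine lt_of_le_of_lt (lintegral_mono fun q => ?_) hsq
    rw [ENNReal.toReal_ofNat, ENNReal.rpow_ofNat, Real.enorm_of_nonneg ENNReal.toReal_nonneg]
    gcongr
    exact ENNReal.ofReal_toReal_le
  refine isCompactOperator_of_inner_eq_integral hk fun f g => ?_
  rw [inner_condExpOp, ← integral_rnDeriv_smul hac]
  rfl

end CondExpOp

section MarkovChain

variable {𝒰 𝒲 𝒵 : Type*} [MeasurableSpace 𝒰] [MeasurableSpace 𝒲] [MeasurableSpace 𝒵]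

theorem comp_eq_of_map_swap_compProd_eq {ρ : Measure 𝒰} [SFinite ρ] {α : Measure 𝒲} [SFinite α]
    {κW : Kernel 𝒰 𝒲} [IsMarkovKernel κW] {κ : Kernel 𝒲 𝒰} [IsSFiniteKernel κ]
    (hκ : (ρ ⊗ₘ κW).map Prod.swap = α ⊗ₘ κ) : κ ∘ₘ α = ρ := by
  rw [← Measure.snd_compProd, ← hκ, Measure.snd_map_swap, Measure.fst_compProd]

/-- The joint law of the ends of a Markov chain `W — U — Z`, where `ρ` is the law of `U` and `κ` the
conditional law of `U` given `W`. -/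
theorem prod_comp_eq_compProd_comp {ρ : Measure 𝒰} [IsFiniteMeasure ρ] {α : Measure 𝒲} [SFinite α]
    {κW : Kernel 𝒰 𝒲} [IsFiniteKernel κW] {κZ : Kernel 𝒰 𝒵} [IsFiniteKernel κZ]
    {κ : Kernel 𝒲 𝒰} [IsFiniteKernel κ] (hκ : (ρ ⊗ₘ κW).map Prod.swap = α ⊗ₘ κ) :
    (κW ×ₖ κZ) ∘ₘ ρ = α ⊗ₘ (κZ ∘ₖ κ) := by
  refine Measure.ext_prod fun {s t} hs ht => ?_
  have hfst : Measurable fun q : 𝒰 × 𝒲 => κZ q.1 t := (κZ.measurable_coe ht).comp measurable_fst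
  have hsnd : Measurable fun q : 𝒲 × 𝒰 => κZ q.2 t := (κZ.measurable_coe ht).comp measurable_snd
  calc ((κW ×ₖ κZ) ∘ₘ ρ) (s ×ˢ t)
      = ∫⁻ u, κZ u t * κW u s ∂ρ := by
        rw [Measure.bind_apply (hs.prod ht) (Kernel.aemeasurable _)]
        simp only [Kernel.prod_apply_prod, mul_comm]
    _ = ∫⁻ q in Set.univ ×ˢ s, κZ q.1 t ∂(ρ ⊗ₘ κW) := by
        rw [Measure.setLIntegral_compProd hfst MeasurableSet.univ hs]
        simp only [setLIntegral_const, Measure.restrict_univ]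
    _ = ∫⁻ q in s ×ˢ Set.univ, κZ q.2 t ∂(α ⊗ₘ κ) := by
        rw [← hκ, setLIntegral_map (hs.prod MeasurableSet.univ) hsnd measurable_swap,
          Set.preimage_swap_prod]
        rfl
    _ = (α ⊗ₘ (κZ ∘ₖ κ)) (s ×ˢ t) := by
        rw [Measure.setLIntegral_compProd hsnd hs MeasurableSet.univ,
          Measure.compProd_apply_prod hs ht]
        simp only [Measure.restrict_univ, Kernel.comp_apply' _ _ _ ht]

theorem adjoint_condExpOp_ae_eq_integral_integral {ρ : Measure 𝒰} [IsFiniteMeasure ρ]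
    {κW : Kernel 𝒰 𝒲} [IsMarkovKernel κW] {κZ : Kernel 𝒰 𝒵} [IsMarkovKernel κZ]
    {κ : Kernel 𝒲 𝒰} [IsMarkovKernel κ] {μ : Measure (𝒲 × 𝒵)} [IsFiniteMeasure μ]
    (hμ : μ = (κW ×ₖ κZ) ∘ₘ ρ) (hκ : (ρ ⊗ₘ κW).map Prod.swap = μ.fst ⊗ₘ κ) (g : Lp ℝ 2 μ.snd) :
    ContinuousLinearMap.adjoint (condExpOp μ) g =ᵐ[μ.fst]
      fun w => ∫ u, ∫ z, g z ∂κZ u ∂κ w := by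
  have hθ : μ = μ.fst ⊗ₘ (κZ ∘ₖ κ) := hμ.trans (prod_comp_eq_compProd_comp hκ)
  have hint : Integrable g ((κZ ∘ₖ κ) ∘ₘ μ.fst) := by
    rw [← Measure.snd_compProd, ← hθ]
    exact (Lp.memLp g).integrable one_le_two
  filter_upwards [adjoint_condExpOp_ae_eq hθ g, Measure.ae_integrable_of_integrable_comp hint]
    with w hw hgw
  rw [hw, Kernel.integral_comp hgw]

/-- The completeness of `W` for `U` enters here: `m(Z) = E{b(U) ∣ Z}` is orthogonal to the kernel of
the adjoint, because `E{g(Z) ∣ W} = E{E{g(Z) ∣ U} ∣ W}` vanishes only if `E{g(Z) ∣ U}` does. -/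
theorem integral_mul_eq_zero_of_adjoint_condExpOp_eq_zero {ρ : Measure 𝒰} [IsFiniteMeasure ρ]
    {κW : Kernel 𝒰 𝒲} [IsMarkovKernel κW] {κZ : Kernel 𝒰 𝒵} [IsMarkovKernel κZ]
    {κ : Kernel 𝒲 𝒰} [IsMarkovKernel κ] {η : Kernel 𝒵 𝒰} [IsMarkovKernel η]
    {μ : Measure (𝒲 × 𝒵)} [IsFiniteMeasure μ] (hμ : μ = (κW ×ₖ κZ) ∘ₘ ρ)
    (hκ : (ρ ⊗ₘ κW).map Prod.swap = μ.fst ⊗ₘ κ) (hη : (ρ ⊗ₘ κZ).map Prod.swap = μ.snd ⊗ₘ η)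
    (hcomplete : ∀ f : 𝒰 → ℝ, MemLp f 2 ρ → (∀ᵐ w ∂μ.fst, ∫ u, f u ∂κ w = 0) →
      ∀ᵐ u ∂ρ, f u = 0)
    {b : 𝒰 → ℝ} (hb : MemLp b 2 ρ) {m : 𝒵 → ℝ} (hm : ∀ᵐ z ∂μ.snd, m z = ∫ u, b u ∂η z)
    {g : Lp ℝ 2 μ.snd} (hg : ContinuousLinearMap.adjoint (condExpOp μ) g = 0) :
    ∫ z, m z * g z ∂μ.snd = 0 := by
  have hU : MeasurePreserving Prod.fst (ρ ⊗ₘ κZ) ρ := ⟨measurable_fst, Measure.fst_compProd ρ κZ⟩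
  have hswap : MeasurePreserving (fun q => (q.2, q.1)) (ρ ⊗ₘ κZ) (μ.snd ⊗ₘ η) :=
    ⟨measurable_swap, hη⟩
  have hZ : MeasurePreserving Prod.snd (ρ ⊗ₘ κZ) μ.snd :=
    (⟨measurable_fst, Measure.fst_compProd μ.snd η⟩ :
      MeasurePreserving Prod.fst (μ.snd ⊗ₘ η) μ.snd).comp hswap
  have hbZ : l2CondExp hU hZ (hb.toLp b) =ᵐ[μ.snd] m := by
    have hbη : ∀ᵐ z ∂μ.snd, hb.toLp b =ᵐ[η z] b := by
      refine Measure.ae_ae_of_ae_comp ?_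
      rw [comp_eq_of_map_swap_compProd_eq hη]
      exact hb.coeFn_toLp
    filter_upwards [l2CondExp_ae_eq hswap measurable_snd hU hZ (hb.toLp b), hm, hbη]
      with z hz hmz hbz
    rw [hz, hmz, integral_congr_ae hbz]
  have hgU : l2CondExp hZ hU g =ᵐ[ρ] fun u => ∫ z, g z ∂κZ u :=
    l2CondExp_ae_eq (V := Prod.fst) (S := Prod.snd) (MeasurePreserving.id _) measurable_snd hZ hU g
  have hgU_zero : l2CondExp hZ hU g = 0 := by
    refine (Lp.eq_zero_iff_ae_eq_zero).2 (hcomplete _ (Lp.memLp _) ?_)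
    have hgκ : ∀ᵐ w ∂μ.fst, l2CondExp hZ hU g =ᵐ[κ w] fun u => ∫ z, g z ∂κZ u := by
      refine Measure.ae_ae_of_ae_comp ?_
      rwa [comp_eq_of_map_swap_compProd_eq hκ]
    filter_upwards [adjoint_condExpOp_ae_eq_integral_integral hμ hκ g, hgκ,
      (Lp.eq_zero_iff_ae_eq_zero).1 hg] with w hw hgw hzero
    rw [integral_congr_ae hgw, ← hw, hzero, Pi.zero_apply]
  calc ∫ z, m z * g z ∂μ.snd = ⟪l2CondExp hU hZ (hb.toLp b), g⟫_ℝ := by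
        rw [inner_Lp_eq_integral]
        refine integral_congr_ae ?_
        filter_upwards [hbZ] with z hz
        rw [hz]
    _ = ⟪hb.toLp b, l2CondExp hZ hU g⟫_ℝ := by
        rw [← adjoint_l2CondExp hU hZ, ContinuousLinearMap.adjoint_inner_right]
    _ = 0 := by rw [hgU_zero, inner_zero_right]

end MarkovChain

section EssentialSupremum

variable {α ι : Type*} [MeasurableSpace α] {ρ : Measure α} [IsFiniteMeasure ρ]

/-- `J` minimises `∫⁻ (1 + ⨆ j ∈ J, f j)⁻¹` among the countable sets of indices: the minimum is
attained at the union of a minimising sequence, and adding an index to `J` cannot lower it. -/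
theorem exists_countable_forall_ae_le_biSup {f : ι → α → ℝ≥0∞} (hf : ∀ i, Measurable (f i)) :
    ∃ J : Set ι, J.Countable ∧ ∀ i, ∀ᵐ x ∂ρ, f i x ≤ ⨆ j ∈ J, f j x := by
  let F (J : Set ι) (x : α) : ℝ≥0∞ := (1 + ⨆ j ∈ J, f j x)⁻¹
  have hF_anti : ∀ {J J' : Set ι}, J ⊆ J' → ∀ x, F J' x ≤ F J x := fun hJ x =>
    ENNReal.inv_le_inv.2 (add_le_add_right (biSup_mono hJ) 1)
  have hF_meas : ∀ {J : Set ι}, J.Countable → Measurable (F J) := fun hJ =>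
    (measurable_const.add (Measurable.biSup _ hJ fun i _ => hf i)).inv
  let S : Set ℝ≥0∞ := (fun J => ∫⁻ x, F J x ∂ρ) '' {J | J.Countable}
  obtain ⟨u, -, hu_tendsto, hu⟩ := exists_seq_tendsto_sInf (S := S)
    ⟨_, ∅, Set.countable_empty, rfl⟩ (OrderBot.bddBelow S)
  choose J hJ_countable hJu using hu
  have hJ : (⋃ n, J n).Countable := Set.countable_iUnion hJ_countable
  have hmin : ∫⁻ x, F (⋃ n, J n) x ∂ρ ≤ sInf S := ge_of_tendsto' hu_tendsto fun n => by
    rw [← hJu n]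
    exact lintegral_mono (hF_anti (Set.subset_iUnion J n))
  have hfinite : ∫⁻ x, F (⋃ n, J n) x ∂ρ ≠ ∞ := by
    refine ne_top_of_le_ne_top (measure_ne_top ρ Set.univ) ?_
    rw [← lintegral_one]
    exact lintegral_mono fun x => ENNReal.inv_le_one.2 le_self_add
  refine ⟨⋃ n, J n, hJ, fun i => ?_⟩
  have hinsert : F (insert i (⋃ n, J n)) =ᵐ[ρ] F (⋃ n, J n) :=
    ae_eq_of_ae_le_of_lintegral_le (ae_of_all _ (hF_anti (Set.subset_insert _ _)))
      (ne_top_of_le_ne_top hfinite (lintegral_mono (hF_anti (Set.subset_insert _ _))))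
      (hF_meas hJ).aemeasurable (hmin.trans (sInf_le ⟨_, hJ.insert i, rfl⟩))
  filter_upwards [hinsert] with x hx
  rw [← (ENNReal.add_right_inj ENNReal.one_ne_top).1 (inv_inj.1 hx)]
  exact le_biSup (fun j => f j x) (Set.mem_insert _ _)

theorem exists_measurable_forall_ae_le_mul {a b : ι → α → ℝ} (ha : ∀ i, Measurable (a i))
    (hb : ∀ i, Measurable (b i)) (hb_nonneg : ∀ i x, 0 ≤ b i x) {M : α → ℝ}
    (hM : ∀ i, ∀ᵐ x ∂ρ, a i x ≤ M x * b i x) :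
    ∃ D : α → ℝ, Measurable D ∧ (∀ x, 0 ≤ D x) ∧ ∀ i, ∀ᵐ x ∂ρ, a i x ≤ D x * b i x := by
  obtain ⟨J, hJ, hsup⟩ := exists_countable_forall_ae_le_biSup (ρ := ρ)
    (f := fun i x => ENNReal.ofReal (a i x / b i x))
    fun i => ((ha i).div (hb i)).ennreal_ofReal
  refine ⟨fun x => (⨆ j ∈ J, ENNReal.ofReal (a j x / b j x)).toReal,
    (Measurable.biSup _ hJ fun j _ => ((ha j).div (hb j)).ennreal_ofReal).ennreal_toReal,
    fun x => ENNReal.toReal_nonneg, fun i => ?_⟩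
  filter_upwards [hsup i, hM i, (ae_ball_iff hJ).2 fun j _ => hM j] with x hsupx hi hMJ
  have hfinite : ⨆ j ∈ J, ENNReal.ofReal (a j x / b j x) ≠ ∞ := by
    refine ne_top_of_le_ne_top (b := ENNReal.ofReal |M x|) ENNReal.ofReal_ne_top
      (iSup₂_le fun j hj => ENNReal.ofReal_le_ofReal ?_)
    refine div_le_of_le_mul₀ (hb_nonneg j x) (abs_nonneg _) ((hMJ j hj).trans ?_)
    exact mul_le_mul_of_nonneg_right (le_abs_self _) (hb_nonneg j x)
  rcases (hb_nonneg i x).eq_or_lt with hzero | hpos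
  · rw [← hzero, mul_zero] at hi ⊢
    exact hi
  · rw [← div_le_iff₀ hpos]
    exact (ENNReal.ofReal_le_iff_le_toReal hfinite).1 hsupx

end EssentialSupremum

section MeasurableSolution

variable {α β 𝒞 𝒲 𝒵 : Type*} [MeasurableSpace α] [MeasurableSpace β] [MeasurableSpace 𝒞]
  [MeasurableSpace 𝒲] [MeasurableSpace 𝒵] {ρ : Measure 𝒞}

theorem measurePreserving_prodAssoc_symm_compProd {κ : Kernel 𝒞 (α × β)} {κ₁ : Kernel 𝒞 α}
    {θ : Kernel (𝒞 × α) β} [IsSFiniteKernel κ] (h : κ =ᵐ[ρ] κ₁ ⊗ₖ θ) :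
    MeasurePreserving MeasurableEquiv.prodAssoc.symm (ρ ⊗ₘ κ) (ρ ⊗ₘ κ₁ ⊗ₘ θ) :=
  ⟨MeasurableEquiv.measurable _, by rw [Measure.compProd_congr h, Measure.compProd_assoc]⟩

theorem measurePreserving_map_compProd [SFinite ρ] {κ : Kernel 𝒞 α} [IsSFiniteKernel κ] {f : α → β}
    (hf : Measurable f) : MeasurePreserving (Prod.map id f) (ρ ⊗ₘ κ) (ρ ⊗ₘ κ.map f) :=
  ⟨measurable_id.prodMap hf, (Measure.compProd_map hf).symm⟩

theorem measurePreserving_compProd_fst [SFinite ρ] (κ : Kernel 𝒞 (α × β)) [IsSFiniteKernel κ] :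
    MeasurePreserving (fun q : 𝒞 × α × β => (q.1, q.2.1)) (ρ ⊗ₘ κ) (ρ ⊗ₘ κ.fst) :=
  κ.fst_eq ▸ measurePreserving_map_compProd measurable_fst

theorem measurePreserving_compProd_snd [SFinite ρ] (κ : Kernel 𝒞 (α × β)) [IsSFiniteKernel κ] :
    MeasurePreserving (fun q : 𝒞 × α × β => (q.1, q.2.2)) (ρ ⊗ₘ κ) (ρ ⊗ₘ κ.snd) :=
  κ.snd_eq ▸ measurePreserving_map_compProd measurable_snd

theorem measurePreserving_swap_compProd [SFinite ρ] {κ : Kernel 𝒞 (α × β)} [IsSFiniteKernel κ]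
    {η : Kernel (𝒞 × β) α} (hη : κ.swapRight =ᵐ[ρ] κ.snd ⊗ₖ η) :
    MeasurePreserving (fun q : 𝒞 × α × β => ((q.1, q.2.2), q.2.1)) (ρ ⊗ₘ κ)
      (ρ ⊗ₘ κ.snd ⊗ₘ η) :=
  (measurePreserving_prodAssoc_symm_compProd hη).comp
    (κ.swapRight_eq ▸ measurePreserving_map_compProd measurable_swap)

theorem measurePreserving_compProd_of_swapRight_ae_eq [SFinite ρ] {κ : Kernel 𝒞 (α × β)}
    [IsSFiniteKernel κ] {η : Kernel (𝒞 × β) α} (hη : κ.swapRight =ᵐ[ρ] κ.snd ⊗ₖ η) :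
    MeasurePreserving (fun q : (𝒞 × β) × α => (q.1.1, q.2)) (ρ ⊗ₘ κ.snd ⊗ₘ η) (ρ ⊗ₘ κ.fst) := by
  have hη_map := measurePreserving_swap_compProd hη
  refine ⟨by fun_prop, ?_⟩
  rw [← hη_map.map_eq, Measure.map_map (by fun_prop) hη_map.measurable]
  exact (measurePreserving_compProd_fst κ).map_eq

variable [IsFiniteMeasure ρ]

theorem sq_integral_mul_le_of_condExpOp_ae_eq {μ : Measure (𝒲 × 𝒵)} [SFinite μ] {θ : Kernel 𝒲 𝒵}
    [IsMarkovKernel θ] (hθ : μ = μ.fst ⊗ₘ θ) {f : Lp ℝ 2 μ.fst} {m g : 𝒵 → ℝ}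
    (hf : condExpOp μ f =ᵐ[μ.snd] m) (hg : MemLp g 2 μ.snd) :
    (∫ z, m z * g z ∂μ.snd) ^ 2 ≤ ‖f‖ ^ 2 * ∫ w, (∫ z, g z ∂θ w) ^ 2 ∂μ.fst := by
  have hinner : ∫ z, m z * g z ∂μ.snd =
      ⟪f, ContinuousLinearMap.adjoint (condExpOp μ) (hg.toLp g)⟫_ℝ := by
    rw [ContinuousLinearMap.adjoint_inner_right, inner_toLp_right]
    refine integral_congr_ae ?_
    filter_upwards [hf] with z hz
    rw [hz]
  have hgθ : ∀ᵐ w ∂μ.fst, hg.toLp g =ᵐ[θ w] g := by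
    refine Measure.ae_ae_of_ae_comp ?_
    rw [← Measure.snd_compProd, ← hθ]
    exact hg.coeFn_toLp
  have hnorm : ‖ContinuousLinearMap.adjoint (condExpOp μ) (hg.toLp g)‖ ^ 2 =
      ∫ w, (∫ z, g z ∂θ w) ^ 2 ∂μ.fst := by
    rw [norm_Lp_sq_eq_integral]
    refine integral_congr_ae ?_
    filter_upwards [adjoint_condExpOp_ae_eq hθ (hg.toLp g), hgθ] with w hw hgw
    rw [hw, integral_congr_ae hgw]
  rw [hinner, ← hnorm, ← mul_pow]
  exact sq_le_sq.2 ((abs_real_inner_le_norm _ _).trans (le_abs_self _))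

theorem sq_integral_compProd_le {κ : Kernel 𝒞 α} [IsSFiniteKernel κ] {κ' : Kernel 𝒞 β}
    [IsSFiniteKernel κ'] {F : 𝒞 × α → ℝ} {G : 𝒞 × β → ℝ} (hF : Integrable F (ρ ⊗ₘ κ))
    (hG : Integrable G (ρ ⊗ₘ κ'))
    (hFG : ∀ᵐ c ∂ρ, (∫ x, F (c, x) ∂κ c) ^ 2 ≤ ∫ y, G (c, y) ∂κ' c) :
    (∫ q, F q ∂(ρ ⊗ₘ κ)) ^ 2 ≤ ρ.real Set.univ * ∫ q, G q ∂(ρ ⊗ₘ κ') := by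
  have hF_meas : AEStronglyMeasurable (fun c => ∫ x, F (c, x) ∂κ c) ρ :=
    (Integrable.integral_compProd hF).1
  have hG_int : Integrable (fun c => ∫ y, G (c, y) ∂κ' c) ρ := Integrable.integral_compProd hG
  have hF_sq : Integrable (fun c => (∫ x, F (c, x) ∂κ c) ^ 2) ρ := by
    refine hG_int.mono' (hF_meas.pow 2) ?_
    filter_upwards [hFG] with c hc
    rwa [Real.norm_of_nonneg (sq_nonneg _)]
  rw [Measure.integral_compProd hF, Measure.integral_compProd hG]
  calc (∫ c, ∫ x, F (c, x) ∂κ c ∂ρ) ^ 2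
      ≤ ρ.real Set.univ * ∫ c, (∫ x, F (c, x) ∂κ c) ^ 2 ∂ρ :=
        sq_integral_le_mul_integral_sq ((memLp_two_iff_integrable_sq hF_meas).2 hF_sq)
    _ ≤ ρ.real Set.univ * ∫ c, ∫ y, G (c, y) ∂κ' c ∂ρ :=
        mul_le_mul_of_nonneg_left (integral_mono_ae hF_sq hG_int hFG) measureReal_nonneg

theorem memLp_compProd_of_ae_integral_sq_le {κ : Kernel 𝒞 α} [IsSFiniteKernel κ] {F : 𝒞 × α → ℝ}
    (hF : StronglyMeasurable F) {C : ℝ} (hFC : ∀ᵐ c ∂ρ, MemLp (fun x => F (c, x)) 2 (κ c) ∧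
      ∫ x, F (c, x) ^ 2 ∂κ c ≤ C) : MemLp F 2 (ρ ⊗ₘ κ) := by
  have hF_sq : StronglyMeasurable fun q => F q ^ 2 := hF.pow 2
  refine (memLp_two_iff_integrable_sq hF.aestronglyMeasurable).2 ?_
  rw [Measure.integrable_compProd_iff hF_sq.aestronglyMeasurable]
  refine ⟨hFC.mono fun c hc => hc.1.integrable_sq, ?_⟩
  simp only [norm_pow, Real.norm_eq_abs, sq_abs]
  refine (integrable_const C).mono'
    hF_sq.integral_kernel_prod_right'.aestronglyMeasurable ?_
  filter_upwards [hFC] with c hc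
  rw [Real.norm_of_nonneg (integral_nonneg fun x => sq_nonneg _)]
  exact hc.2

variable {κ : Kernel 𝒞 (𝒲 × 𝒵)} [IsMarkovKernel κ] {θ : Kernel (𝒞 × 𝒲) 𝒵} [IsMarkovKernel θ]
  {η : Kernel (𝒞 × 𝒵) 𝒲} [IsMarkovKernel η] {m : 𝒞 × 𝒵 → ℝ}

/-- Douglas' criterion for the conditional expectation `h ↦ E{h(C, W) ∣ C, Z = ·}`, whose adjoint
`g ↦ E{g(C, Z) ∣ C, W = ·}` acts fibrewise. -/
theorem exists_ae_eq_integral_of_sq_integral_mul_le (hθ : κ =ᵐ[ρ] κ.fst ⊗ₖ θ)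
    (hη : κ.swapRight =ᵐ[ρ] κ.snd ⊗ₖ η) (hm : MemLp m 2 (ρ ⊗ₘ κ.snd))
    (hbound : ∀ g : Lp ℝ 2 (ρ ⊗ₘ κ.snd), ∀ᵐ c ∂ρ, (∫ z, m (c, z) * g (c, z) ∂κ.snd c) ^ 2 ≤
      ∫ w, (∫ z, g (c, z) ∂θ (c, w)) ^ 2 ∂κ.fst c) :
    ∃ h : Lp ℝ 2 (ρ ⊗ₘ κ.fst), m =ᵐ[ρ ⊗ₘ κ.snd] fun q => ∫ w, h (q.1, w) ∂η q := by
  have hCW := measurePreserving_compProd_fst (ρ := ρ) κ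
  have hCZ := measurePreserving_compProd_snd (ρ := ρ) κ
  have hadjoint (g : Lp ℝ 2 (ρ ⊗ₘ κ.snd)) :
      l2CondExp hCZ hCW g =ᵐ[ρ ⊗ₘ κ.fst] fun q => ∫ z, g (q.1, z) ∂θ q :=
    l2CondExp_ae_eq (measurePreserving_prodAssoc_symm_compProd hθ) (ψ := fun q => (q.1.1, q.2))
      (by fun_prop) hCZ hCW g
  obtain ⟨h, hh⟩ := exists_apply_eq_of_abs_inner_le (K := l2CondExp hCW hCZ) (m := hm.toLp m)
    (C := √(ρ.real Set.univ)) fun g => by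
      have hmg : Integrable (fun q => m q * g q) (ρ ⊗ₘ κ.snd) := hm.integrable_mul (Lp.memLp g)
      have hg : Integrable (fun q => (∫ z, g (q.1, z) ∂θ q) ^ 2) (ρ ⊗ₘ κ.fst) :=
        ((Lp.memLp _).ae_eq (hadjoint g)).integrable_sq
      have hnorm : ‖l2CondExp hCZ hCW g‖ ^ 2 =
          ∫ q, (∫ z, g (q.1, z) ∂θ q) ^ 2 ∂(ρ ⊗ₘ κ.fst) := by
        rw [norm_Lp_sq_eq_integral]
        exact integral_congr_ae ((hadjoint g).fun_comp (· ^ 2))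
      rw [adjoint_l2CondExp]
      refine abs_le_of_sq_le_sq ?_ (by positivity)
      rw [mul_pow, Real.sq_sqrt measureReal_nonneg, hnorm, real_inner_comm, inner_toLp_right]
      simp only [mul_comm (g _)]
      exact sq_integral_compProd_le hmg hg (hbound g)
  refine ⟨h, ?_⟩
  filter_upwards [hm.coeFn_toLp, l2CondExp_ae_eq (measurePreserving_swap_compProd hη)
    (ψ := fun q => (q.1.1, q.2)) (by fun_prop) hCW hCZ h] with q hmq hq
  rw [← hmq, ← hh, hq]

theorem exists_measurable_forall_sq_integral_mul_le (hθ : κ =ᵐ[ρ] κ.fst ⊗ₖ θ)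
    (hm : StronglyMeasurable m)
    (hsolv : ∀ᵐ c ∂ρ, ∃ f, condExpOp (κ c) f =ᵐ[(κ c).snd] fun z => m (c, z)) :
    ∃ D : 𝒞 → ℝ, Measurable D ∧ (∀ c, 0 ≤ D c) ∧ ∀ g : Lp ℝ 2 (ρ ⊗ₘ κ.snd), ∀ᵐ c ∂ρ,
      (∫ z, m (c, z) * g (c, z) ∂κ.snd c) ^ 2 ≤
        D c * ∫ w, (∫ z, g (c, z) ∂θ (c, w)) ^ 2 ∂κ.fst c := by
  have hfibre : ∀ᵐ c ∂ρ, ∃ M : ℝ, ∀ g, MemLp g 2 (κ.snd c) →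
      (∫ z, m (c, z) * g z ∂κ.snd c) ^ 2 ≤ M * ∫ w, (∫ z, g z ∂θ (c, w)) ^ 2 ∂κ.fst c := by
    filter_upwards [hθ, hsolv] with c hc ⟨f, hf⟩
    rw [Kernel.compProd_apply_eq_compProd_sectR] at hc
    exact ⟨‖f‖ ^ 2, fun g hg => sq_integral_mul_le_of_condExpOp_ae_eq hc hf hg⟩
  obtain ⟨M, hM⟩ := skolem.1 hfibre
  have hg_cond (g : Lp ℝ 2 (ρ ⊗ₘ κ.snd)) :
      StronglyMeasurable fun q : 𝒞 × 𝒲 => (∫ z, g (q.1, z) ∂θ q) ^ 2 :=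
    (((Lp.stronglyMeasurable g).comp_measurable (g := fun q : (𝒞 × 𝒲) × 𝒵 => (q.1.1, q.2))
      (by fun_prop)).integral_kernel_prod_right' (κ := θ)).pow 2
  refine exists_measurable_forall_ae_le_mul (M := M)
    (fun g => ((hm.mul (Lp.stronglyMeasurable g)).integral_kernel_prod_right'.pow 2).measurable)
    (fun g => (hg_cond g).integral_kernel_prod_right'.measurable)
    (fun g c => integral_nonneg fun w => sq_nonneg _) fun g => ?_
  filter_upwards [hM, ae_memLp_of_memLp_compProd (Lp.memLp g)] with c hc hg
  exact hc _ hg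

theorem inv_one_add_add_sq_mul_le_one {a b : ℝ} (ha : 0 ≤ a) (hb : 0 ≤ b) :
    (1 + a + b)⁻¹ ^ 2 * a ≤ 1 := by
  rw [inv_pow, inv_mul_le_one₀ (by positivity)]
  nlinarith

theorem exists_weight_forall_sq_integral_mul_le (hθ : κ =ᵐ[ρ] κ.fst ⊗ₖ θ)
    (hm : StronglyMeasurable m) (hm_sq : ∀ᵐ c ∂ρ, MemLp (fun z => m (c, z)) 2 (κ.snd c))
    (hsolv : ∀ᵐ c ∂ρ, ∃ f, condExpOp (κ c) f =ᵐ[(κ c).snd] fun z => m (c, z)) :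
    ∃ v : 𝒞 → ℝ, Measurable v ∧ (∀ c, 0 < v c) ∧
      MemLp (fun q => v q.1 * m q) 2 (ρ ⊗ₘ κ.snd) ∧
      ∀ g : Lp ℝ 2 (ρ ⊗ₘ κ.snd), ∀ᵐ c ∂ρ, (∫ z, v c * m (c, z) * g (c, z) ∂κ.snd c) ^ 2 ≤
        ∫ w, (∫ z, g (c, z) ∂θ (c, w)) ^ 2 ∂κ.fst c := by
  obtain ⟨D, hD_meas, hD, hDg⟩ := exists_measurable_forall_sq_integral_mul_le hθ hm hsolv
  have hQ (c : 𝒞) : 0 ≤ ∫ z, m (c, z) ^ 2 ∂κ.snd c := integral_nonneg fun z => sq_nonneg _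
  have hQ_meas : Measurable fun c => ∫ z, m (c, z) ^ 2 ∂κ.snd c :=
    (hm.pow 2).integral_kernel_prod_right'.measurable
  have hv_meas : Measurable fun c => (1 + D c + ∫ z, m (c, z) ^ 2 ∂κ.snd c)⁻¹ :=
    ((hD_meas.const_add 1).add hQ_meas).inv
  refine ⟨_, hv_meas, fun c => inv_pos.2 (add_pos_of_pos_of_nonneg
    (add_pos_of_pos_of_nonneg one_pos (hD c)) (hQ c)), ?_, fun g => ?_⟩
  · refine memLp_compProd_of_ae_integral_sq_le (C := 1)
      ((hv_meas.comp measurable_fst).stronglyMeasurable.mul hm) (hm_sq.mono fun c hc => ?_)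
    refine ⟨hc.const_mul (1 + D c + ∫ z, m (c, z) ^ 2 ∂κ.snd c)⁻¹, ?_⟩
    simp only [mul_pow, integral_const_mul]
    rw [add_right_comm]
    exact inv_one_add_add_sq_mul_le_one (hQ c) (hD c)
  · filter_upwards [hDg g] with c hc
    simp only [mul_assoc, integral_const_mul, mul_pow]
    refine (mul_le_mul_of_nonneg_left hc (sq_nonneg _)).trans ?_
    rw [← mul_assoc]
    exact mul_le_of_le_one_left (integral_nonneg fun w => sq_nonneg _)
      (inv_one_add_add_sq_mul_le_one (hD c) (hQ c))

theorem exists_measurable_eq_integral (hθ : κ =ᵐ[ρ] κ.fst ⊗ₖ θ)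
    (hη : κ.swapRight =ᵐ[ρ] κ.snd ⊗ₖ η) (hm : StronglyMeasurable m)
    (hm_sq : ∀ᵐ c ∂ρ, MemLp (fun z => m (c, z)) 2 (κ.snd c))
    (hsolv : ∀ᵐ c ∂ρ, ∃ f, condExpOp (κ c) f =ᵐ[(κ c).snd] fun z => m (c, z)) :
    ∃ h : 𝒞 × 𝒲 → ℝ, Measurable h ∧ (∀ᵐ c ∂ρ, MemLp (fun w => h (c, w)) 2 (κ.fst c)) ∧
      ∀ᵐ q ∂(ρ ⊗ₘ κ.snd), Integrable (fun w => h (q.1, w)) (η q) ∧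
        m q = ∫ w, h (q.1, w) ∂η q := by
  obtain ⟨v, hv_meas, hv, hvm, hbound⟩ :=
    exists_weight_forall_sq_integral_mul_le hθ hm hm_sq hsolv
  obtain ⟨h, hh⟩ := exists_ae_eq_integral_of_sq_integral_mul_le hθ hη hvm hbound
  have hh_sq := ae_memLp_of_memLp_compProd (Lp.memLp h)
  have hh_int : ∀ᵐ q ∂(ρ ⊗ₘ κ.snd), MemLp (fun w => h (q.1, w)) 2 (η q) :=
    ae_memLp_of_memLp_compProd
      ((Lp.memLp h).comp_measurePreserving (measurePreserving_compProd_of_swapRight_ae_eq hη))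
  refine ⟨fun q => (v q.1)⁻¹ * h q, by fun_prop, hh_sq.mono fun c hc => hc.const_mul (v c)⁻¹, ?_⟩
  filter_upwards [hh, hh_int] with q hq hq_int
  refine ⟨(hq_int.integrable one_le_two).const_mul _, ?_⟩
  rw [integral_const_mul, ← hq, inv_mul_cancel_left₀ (hv q.1).ne']

end MeasurableSolution

section CondDistrib

variable {Ω 𝒞 α β γ : Type*} [MeasurableSpace Ω] [MeasurableSpace 𝒞] [MeasurableSpace α]
  [MeasurableSpace β] [MeasurableSpace γ] {P : Measure Ω} {S : Ω → α} {T : Ω → β}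
  {C : Ω → 𝒞}

theorem compProd_map_swap_swapLeft (ν : Measure (α × 𝒞)) [SFinite ν] (κ : Kernel (α × 𝒞) β)
    [IsSFiniteKernel κ] :
    ν.map Prod.swap ⊗ₘ κ.swapLeft = (ν ⊗ₘ κ).map (Prod.map Prod.swap id) := by
  have hmeas : Measurable (Prod.map Prod.swap id : (α × 𝒞) × β → (𝒞 × α) × β) :=
    measurable_swap.prodMap measurable_id
  ext s hs
  rw [Measure.compProd_apply hs, Measure.map_apply hmeas hs, Measure.compProd_apply (hmeas hs),
    lintegral_map (Kernel.measurable_kernel_prodMk_left hs) measurable_swap]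
  rfl

theorem measurePreserving_map_prodMk_swap (hS : Measurable S) (hT : Measurable T) :
    MeasurePreserving Prod.swap (P.map fun ω => (S ω, T ω)) (P.map fun ω => (T ω, S ω)) :=
  ⟨measurable_swap, Measure.map_map measurable_swap (hS.prodMk hT)⟩

variable [IsFiniteMeasure P] [StandardBorelSpace α] [Nonempty α]

theorem ae_ae_condDistrib_of_ae_map (hS : Measurable S) (hC : Measurable C) {p : α × 𝒞 → Prop}
    (hp : ∀ᵐ t ∂P.map (fun ω => (S ω, C ω)), p t) :
    ∀ᵐ c ∂P.map C, ∀ᵐ s ∂condDistrib S C P c, p (s, c) := by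
  refine Measure.ae_ae_of_ae_compProd (p := fun q => p q.swap) ?_
  rw [compProd_map_condDistrib hS.aemeasurable]
  exact (measurePreserving_map_prodMk_swap hC hS).quasiMeasurePreserving.ae hp

theorem stronglyMeasurable_condMean (Y : Ω → ℝ) : StronglyMeasurable (condMean P Y C) :=
  StronglyMeasurable.integral_condDistrib (f := fun p : 𝒞 × ℝ => p.2)
    measurable_snd.stronglyMeasurable

theorem condMean_ae_eq_integral_condMean [StandardBorelSpace Ω] [StandardBorelSpace γ] [Nonempty γ]
    {Y : Ω → ℝ} {R : Ω → γ} (hR : Measurable R) (hS : Measurable S) (hY : Measurable Y)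
    (hC : Measurable C) (hY_int : Integrable Y P)
    (hind : CondIndepFun (MeasurableSpace.comap (fun ω => (R ω, C ω)) inferInstance)
      (hR.prodMk hC).comap_le S Y P) :
    ∀ᵐ t ∂P.map (fun ω => (S ω, C ω)), condMean P Y (fun ω => (S ω, C ω)) t =
      ∫ r, condMean P Y (fun ω => (R ω, C ω)) (r, t.2)
        ∂condDistrib R (fun ω => (S ω, C ω)) P t := by
  have hSC : Measurable fun ω => (S ω, C ω) := hS.prodMk hC
  have hRCS : Measurable fun ω => ((R ω, C ω), S ω) := (hR.prodMk hC).prodMk hS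
  have hb : StronglyMeasurable fun q : (α × 𝒞) × γ =>
      condMean P Y (fun ω => (R ω, C ω)) (q.2, q.1.2) :=
    (stronglyMeasurable_condMean Y).comp_measurable (by fun_prop)
  have hcond : P[Y | MeasurableSpace.comap (fun ω => ((R ω, C ω), S ω)) inferInstance] =ᵐ[P]
      fun ω => condMean P Y (fun ω => (R ω, C ω)) (R ω, C ω) := by
    rw [condIndepFun_iff_condDistrib_prod_ae_eq_prodMkRight hY hS (hR.prodMk hC)] at hind
    filter_upwards [condExp_ae_eq_integral_condDistrib' hRCS hY_int,
      ae_of_ae_map hRCS.aemeasurable hind] with ω hcondExp hω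
    rw [hcondExp, hω]
    rfl
  have hle : MeasurableSpace.comap (fun ω => (S ω, C ω)) inferInstance ≤
      MeasurableSpace.comap (fun ω => ((R ω, C ω), S ω)) inferInstance :=
    Measurable.comap_le ((by fun_prop : Measurable fun q : (γ × 𝒞) × α => (q.2, q.1.2)).comp
      (comap_measurable fun ω => ((R ω, C ω), S ω)))
  rw [ae_map_iff hSC.aemeasurable (measurableSet_eq_fun (stronglyMeasurable_condMean Y).measurable
    hb.integral_condDistrib.measurable)]
  calc (fun ω => condMean P Y (fun ω => (S ω, C ω)) (S ω, C ω))
      =ᵐ[P] P[Y | MeasurableSpace.comap (fun ω => (S ω, C ω)) inferInstance] :=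
        (condExp_ae_eq_integral_condDistrib' hSC hY_int).symm
    _ =ᵐ[P] P[P[Y | MeasurableSpace.comap (fun ω => ((R ω, C ω), S ω)) inferInstance] |
          MeasurableSpace.comap (fun ω => (S ω, C ω)) inferInstance] :=
        (condExp_condExp_of_le hle hRCS.comap_le).symm
    _ =ᵐ[P] P[fun ω => condMean P Y (fun ω => (R ω, C ω)) (R ω, C ω) |
          MeasurableSpace.comap (fun ω => (S ω, C ω)) inferInstance] := condExp_congr_ae hcond
    _ =ᵐ[P] _ := condExp_prod_ae_eq_integral_condDistrib hSC hR.aemeasurable hb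
        (integrable_condExp.congr hcond)

variable [StandardBorelSpace β] [Nonempty β]

theorem fst_condDistrib_ae_eq (hS : Measurable S) (hT : Measurable T) :
    (condDistrib (fun ω => (S ω, T ω)) C P).fst =ᵐ[P.map C] condDistrib S C P := by
  rw [Kernel.fst_eq]
  exact (condDistrib_comp C (hS.prodMk hT).aemeasurable measurable_fst).symm

theorem snd_condDistrib_ae_eq (hS : Measurable S) (hT : Measurable T) :
    (condDistrib (fun ω => (S ω, T ω)) C P).snd =ᵐ[P.map C] condDistrib T C P := by
  rw [Kernel.snd_eq]
  exact (condDistrib_comp C (hS.prodMk hT).aemeasurable measurable_snd).symm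

theorem swapRight_condDistrib_ae_eq (hS : Measurable S) (hT : Measurable T) :
    (condDistrib (fun ω => (S ω, T ω)) C P).swapRight =ᵐ[P.map C]
      condDistrib (fun ω => (T ω, S ω)) C P := by
  rw [Kernel.swapRight_eq]
  exact (condDistrib_comp C (hS.prodMk hT).aemeasurable measurable_swap).symm

theorem condDistrib_prodMk_ae_eq_compProd (hS : Measurable S) (hT : Measurable T)
    (hC : Measurable C) :
    condDistrib (fun ω => (S ω, T ω)) C P =ᵐ[P.map C]
      condDistrib S C P ⊗ₖ (condDistrib T (fun ω => (S ω, C ω)) P).swapLeft := by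
  refine condDistrib_ae_eq_of_measure_eq_compProd C (hS.prodMk hT).aemeasurable ?_
  rw [← Measure.compProd_assoc', compProd_map_condDistrib hS.aemeasurable,
    ← (measurePreserving_map_prodMk_swap hS hC).map_eq, compProd_map_swap_swapLeft,
    compProd_map_condDistrib hT.aemeasurable,
    Measure.map_map (by fun_prop) ((hS.prodMk hC).prodMk hT), Measure.map_map (by fun_prop)
      ((measurable_swap.prodMap measurable_id).comp ((hS.prodMk hC).prodMk hT))]
  rfl

theorem condDistrib_prodMk_ae_eq_fst_compProd (hS : Measurable S) (hT : Measurable T)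
    (hC : Measurable C) :
    condDistrib (fun ω => (S ω, T ω)) C P =ᵐ[P.map C]
      (condDistrib (fun ω => (S ω, T ω)) C P).fst ⊗ₖ
        (condDistrib T (fun ω => (S ω, C ω)) P).swapLeft := by
  filter_upwards [condDistrib_prodMk_ae_eq_compProd (P := P) hS hT hC,
    fst_condDistrib_ae_eq (P := P) (C := C) hS hT] with c hc hfst
  rw [hc, Kernel.compProd_apply_eq_compProd_sectR, Kernel.compProd_apply_eq_compProd_sectR, hfst]

theorem swapRight_condDistrib_ae_eq_snd_compProd (hS : Measurable S) (hT : Measurable T)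
    (hC : Measurable C) :
    (condDistrib (fun ω => (S ω, T ω)) C P).swapRight =ᵐ[P.map C]
      (condDistrib (fun ω => (S ω, T ω)) C P).snd ⊗ₖ
        (condDistrib S (fun ω => (T ω, C ω)) P).swapLeft := by
  filter_upwards [swapRight_condDistrib_ae_eq (P := P) (C := C) hS hT,
    condDistrib_prodMk_ae_eq_compProd (P := P) hT hS hC,
    snd_condDistrib_ae_eq (P := P) (C := C) hS hT] with c hswap hc hsnd
  rw [hswap, hc, Kernel.compProd_apply_eq_compProd_sectR, Kernel.compProd_apply_eq_compProd_sectR,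
    hsnd]

theorem map_swap_compProd_condDistrib_ae_eq (hS : Measurable S) (hT : Measurable T)
    (hC : Measurable C) : ∀ᵐ c ∂P.map C,
      (condDistrib S C P c ⊗ₘ (condDistrib T (fun ω => (S ω, C ω)) P).sectL c).map Prod.swap =
        condDistrib T C P c ⊗ₘ (condDistrib S (fun ω => (T ω, C ω)) P).sectL c := by
  filter_upwards [swapRight_condDistrib_ae_eq (P := P) (C := C) hS hT,
    condDistrib_prodMk_ae_eq_compProd (P := P) hS hT hC,
    condDistrib_prodMk_ae_eq_compProd (P := P) hT hS hC] with c hswap hST hTS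
  rw [Kernel.swapRight_apply, hST, hTS, Kernel.compProd_apply_eq_compProd_sectR,
    Kernel.compProd_apply_eq_compProd_sectR] at hswap
  exact hswap

theorem condDistrib_prodMk_ae_eq_prod_comp [StandardBorelSpace Ω] [StandardBorelSpace γ]
    [Nonempty γ] {R : Ω → γ} (hR : Measurable R) (hS : Measurable S) (hT : Measurable T)
    (hC : Measurable C)
    (hind : CondIndepFun (MeasurableSpace.comap (fun ω => (R ω, C ω)) inferInstance)
      (hR.prodMk hC).comap_le S T P) : ∀ᵐ c ∂P.map C,
    condDistrib (fun ω => (S ω, T ω)) C P c =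
      ((condDistrib S (fun ω => (R ω, C ω)) P).sectL c ×ₖ
        (condDistrib T (fun ω => (R ω, C ω)) P).sectL c) ∘ₘ condDistrib R C P c := by
  rw [condIndepFun_iff_map_prod_eq_prod_condDistrib_prod_condDistrib hS hT (hR.prodMk hC),
    ← Measure.compProd_eq_comp_prod,
    ← condDistrib_ae_eq_iff_measure_eq_compProd _ (hS.prodMk hT).aemeasurable] at hind
  filter_upwards [ae_ae_condDistrib_of_ae_map hR hC hind,
    condDistrib_prodMk_ae_eq_compProd (P := P) hR (hS.prodMk hT) hC,
    snd_condDistrib_ae_eq (P := P) (C := C) hR (hS.prodMk hT)] with c hprod hc hsnd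
  rw [← hsnd, Kernel.snd_apply, hc, Kernel.compProd_apply_eq_compProd_sectR, ← Measure.snd,
    Measure.snd_compProd]
  refine Measure.bind_congr_right ?_
  filter_upwards [hprod] with r hr
  rw [Kernel.prod_apply]
  exact hr.trans (Kernel.prod_apply _ _ _)

theorem exists_measurable_eq_integral_condDistrib (hS : Measurable S) (hT : Measurable T)
    (hC : Measurable C) {m : β × 𝒞 → ℝ} (hm : StronglyMeasurable m)
    (hm_sq : ∀ᵐ c ∂P.map C,
      MemLp (fun t => m (t, c)) 2 (condDistrib (fun ω => (S ω, T ω)) C P c).snd)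
    (hsolv : ∀ᵐ c ∂P.map C, ∃ f, condExpOp (condDistrib (fun ω => (S ω, T ω)) C P c) f
      =ᵐ[(condDistrib (fun ω => (S ω, T ω)) C P c).snd] fun t => m (t, c)) :
    ∃ h : α × 𝒞 → ℝ, Measurable h ∧
      (∀ᵐ c ∂P.map C, MemLp (fun s => h (s, c)) 2 (condDistrib S C P c)) ∧
      ∀ᵐ q ∂P.map (fun ω => (T ω, C ω)),
        Integrable (fun s => h (s, q.2)) (condDistrib S (fun ω => (T ω, C ω)) P q) ∧
          m q = ∫ s, h (s, q.2) ∂condDistrib S (fun ω => (T ω, C ω)) P q := by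
  obtain ⟨h, hh_meas, hh_sq, hh⟩ := exists_measurable_eq_integral (m := fun q => m q.swap)
    (condDistrib_prodMk_ae_eq_fst_compProd hS hT hC)
    (swapRight_condDistrib_ae_eq_snd_compProd hS hT hC)
    (hm.comp_measurable measurable_swap) hm_sq hsolv
  refine ⟨fun q => h q.swap, hh_meas.comp measurable_swap, ?_, ?_⟩
  · filter_upwards [hh_sq, fst_condDistrib_ae_eq (P := P) (C := C) hS hT] with c hc hfst
    rwa [hfst] at hc
  · rw [Measure.compProd_congr (snd_condDistrib_ae_eq hS hT),
      compProd_map_condDistrib hT.aemeasurable] at hh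
    exact (measurePreserving_map_prodMk_swap hT hC).quasiMeasurePreserving.ae hh

end CondDistrib

theorem comap_prodMk_left_comm {Ω α β γ : Type*} [MeasurableSpace α] [MeasurableSpace β]
    [MeasurableSpace γ] (A : Ω → α) (B : Ω → β) (C : Ω → γ) :
    MeasurableSpace.comap (fun ω => (A ω, B ω, C ω)) inferInstance =
      MeasurableSpace.comap (fun ω => (B ω, A ω, C ω)) inferInstance :=
  le_antisymm
    (Measurable.comap_le ((by fun_prop : Measurable fun t : β × α × γ => (t.2.1, t.1, t.2.2)).comp
      (comap_measurable fun ω => (B ω, A ω, C ω))))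
    (Measurable.comap_le ((by fun_prop : Measurable fun t : α × β × γ => (t.2.1, t.1, t.2.2)).comp
      (comap_measurable fun ω => (A ω, B ω, C ω))))

theorem condIndepFun_prodMk_left_comm {Ω α β γ δ ε : Type*} [MeasurableSpace Ω]
    [StandardBorelSpace Ω] [MeasurableSpace α] [MeasurableSpace β] [MeasurableSpace γ]
    [MeasurableSpace δ] [MeasurableSpace ε] {P : Measure Ω} [IsFiniteMeasure P] {A : Ω → α}
    {B : Ω → β} {C : Ω → γ} {f : Ω → δ} {g : Ω → ε} (hA : Measurable A) (hB : Measurable B)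
    (hC : Measurable C)
    (h : CondIndepFun (MeasurableSpace.comap (fun ω => (A ω, B ω, C ω)) inferInstance)
      (hA.prodMk (hB.prodMk hC)).comap_le f g P) :
    CondIndepFun (MeasurableSpace.comap (fun ω => (B ω, A ω, C ω)) inferInstance)
      (hB.prodMk (hA.prodMk hC)).comap_le f g P := by
  convert h using 1
  exact comap_prodMk_left_comm B A C

section Solvability

variable {Ω 𝒲 𝒵 𝒰 𝒜 𝒳 : Type*} [MeasurableSpace Ω]
  [MeasurableSpace 𝒲] [StandardBorelSpace 𝒲] [Nonempty 𝒲]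
  [MeasurableSpace 𝒵] [StandardBorelSpace 𝒵] [Nonempty 𝒵]
  [MeasurableSpace 𝒰] [StandardBorelSpace 𝒰] [Nonempty 𝒰]
  [MeasurableSpace 𝒜] [MeasurableSpace 𝒳] {P : Measure Ω} [IsFiniteMeasure P]
  {Y : Ω → ℝ} {W : Ω → 𝒲} {Z : Ω → 𝒵} {U : Ω → 𝒰} {A : Ω → 𝒜} {X : Ω → 𝒳}

theorem ae_integral_condMean_mul_eq_zero [StandardBorelSpace Ω] (hW : Measurable W)
    (hZ : Measurable Z) (hU : Measurable U) (hA : Measurable A) (hX : Measurable X)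
    (hY : Measurable Y) (hY_int : Integrable Y P)
    (hZY : CondIndepFun (MeasurableSpace.comap (fun ω => (U ω, A ω, X ω)) inferInstance)
      (hU.prodMk (hA.prodMk hX)).comap_le Z Y P)
    (hZW : CondIndepFun (MeasurableSpace.comap (fun ω => (U ω, A ω, X ω)) inferInstance)
      (hU.prodMk (hA.prodMk hX)).comap_le Z W P)
    (hrel : ∀ᵐ c ∂(P.map fun ω => (A ω, X ω)), RelevantAt P W U A X c.1 c.2)
    (hYU : ∀ᵐ c ∂(P.map fun ω => (A ω, X ω)),
      MemLp (fun u => condMean P Y (fun ω => (U ω, A ω, X ω)) (u, c.1, c.2)) 2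
        (condDistrib U (fun ω => (A ω, X ω)) P c)) :
    ∀ᵐ c ∂(P.map fun ω => (A ω, X ω)), ∀ g : Lp ℝ 2 (lawWZ P W Z A X c.1 c.2).snd,
      ContinuousLinearMap.adjoint (condExpOp (lawWZ P W Z A X c.1 c.2)) g = 0 →
      ∫ z, condMean P Y (fun ω => (Z ω, A ω, X ω)) (z, c) * g z
        ∂(lawWZ P W Z A X c.1 c.2).snd = 0 := by
  have hC : Measurable fun ω => (A ω, X ω) := hA.prodMk hX
  filter_upwards [hrel, hYU, fst_condDistrib_ae_eq (P := P) (C := fun ω => (A ω, X ω)) hW hZ,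
    snd_condDistrib_ae_eq (P := P) (C := fun ω => (A ω, X ω)) hW hZ,
    condDistrib_prodMk_ae_eq_prod_comp hU hW hZ hC hZW.symm,
    map_swap_compProd_condDistrib_ae_eq (P := P) hU hW hC,
    map_swap_compProd_condDistrib_ae_eq (P := P) hU hZ hC,
    ae_ae_condDistrib_of_ae_map hZ hC
      (condMean_ae_eq_integral_condMean hU hZ hY hC hY_int hZY)]
    with c hrel hb hfst hsnd hmix hBayesW hBayesZ hm g hg
  rw [← hfst] at hBayesW
  rw [← hsnd] at hBayesZ hm
  refine integral_mul_eq_zero_of_adjoint_condExpOp_eq_zero hmix hBayesW hBayesZ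
    (fun f hf hf0 => hrel f hf ?_) hb hm hg
  rw [← hfst]
  exact hf0

namespace RegularAt

theorem exists_condExpOp_ae_eq {a : 𝒜} {x : 𝒳} (hreg : RegularAt P Y W Z A X a x)
    (hker : ∀ g : Lp ℝ 2 (lawWZ P W Z A X a x).snd,
      ContinuousLinearMap.adjoint (condExpOp (lawWZ P W Z A X a x)) g = 0 →
      ∫ z, condMean P Y (fun ω => (Z ω, A ω, X ω)) (z, a, x) * g z
        ∂(lawWZ P W Z A X a x).snd = 0) :
    ∃ h, condExpOp (lawWZ P W Z A X a x) h =ᵐ[(lawWZ P W Z A X a x).snd]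
      fun z => condMean P Y (fun ω => (Z ω, A ω, X ω)) (z, a, x) := by
  have : IsFiniteMeasure (lawWZ P W Z A X a x) := by
    unfold lawWZ
    infer_instance
  have hinner (g : Lp ℝ 2 (lawWZ P W Z A X a x).snd) : ⟪hreg.mean_sq.toLp _, g⟫_ℝ =
      ∫ z, condMean P Y (fun ω => (Z ω, A ω, X ω)) (z, a, x) * g z
        ∂(lawWZ P W Z A X a x).snd := by
    simp only [real_inner_comm, inner_toLp_right, mul_comm]
  obtain ⟨ι, ν, υ, κ, hS⟩ := exists_isSingularSystem_of_isCompactOperator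
    (isCompactOperator_condExpOp _ hreg.absolutelyContinuous hreg.kernel_sq)
  obtain ⟨h, hh⟩ := hS.exists_apply_eq (fun g hg => (hinner g).trans (hker g hg))
    (by simpa only [hinner] using hreg.picard ι ν υ κ hS)
  exact ⟨h, hh ▸ hreg.mean_sq.coeFn_toLp⟩

end RegularAt

end Solvability

theorem lemmaA2_general {Ω 𝒲 𝒵 𝒰 𝒜 𝒳 : Type*}
    [MeasurableSpace Ω] [StandardBorelSpace Ω]
    [MeasurableSpace 𝒲] [StandardBorelSpace 𝒲] [Nonempty 𝒲]
    [MeasurableSpace 𝒵] [StandardBorelSpace 𝒵] [Nonempty 𝒵]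
    [MeasurableSpace 𝒰] [StandardBorelSpace 𝒰] [Nonempty 𝒰]
    [MeasurableSpace 𝒜] [MeasurableSpace 𝒳]
    (P : Measure Ω) [IsFiniteMeasure P]
    (Y : Ω → ℝ) (W : Ω → 𝒲) (Z : Ω → 𝒵) (U : Ω → 𝒰) (A : Ω → 𝒜) (X : Ω → 𝒳)
    (hW : Measurable W) (hZ : Measurable Z) (hU : Measurable U)
    (hA : Measurable A) (hX : Measurable X)
    (hY : Measurable Y) (hYint : Integrable Y P)
    (hZY : CondIndepFun (MeasurableSpace.comap (fun ω => (A ω, U ω, X ω)) inferInstance)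
      (hA.prodMk (hU.prodMk hX)).comap_le Z Y P)
    (hZW : CondIndepFun (MeasurableSpace.comap (fun ω => (A ω, U ω, X ω)) inferInstance)
      (hA.prodMk (hU.prodMk hX)).comap_le Z W P)
    (hrel : ∀ᵐ c ∂(P.map fun ω => (A ω, X ω)), RelevantAt P W U A X c.1 c.2)
    (hreg : ∀ᵐ c ∂(P.map fun ω => (A ω, X ω)), RegularAt P Y W Z A X c.1 c.2)
    (hYU : ∀ᵐ c ∂(P.map fun ω => (A ω, X ω)),
      MemLp (fun u => condMean P Y (fun ω => (U ω, A ω, X ω)) (u, c.1, c.2)) 2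
        (condDistrib U (fun ω => (A ω, X ω)) P c)) :
    ∃ h : 𝒲 → 𝒜 → 𝒳 → ℝ,
      Measurable (fun q : 𝒲 × 𝒜 × 𝒳 => h q.1 q.2.1 q.2.2) ∧
      (∀ᵐ c ∂(P.map fun ω => (A ω, X ω)),
        MemLp (fun w => h w c.1 c.2) 2 (condDistrib W (fun ω => (A ω, X ω)) P c)) ∧
      ∀ᵐ t ∂(P.map fun ω => (Z ω, A ω, X ω)),
        Integrable (fun w => h w t.2.1 t.2.2)
          (condDistrib W (fun ω => (Z ω, A ω, X ω)) P t) ∧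
        condMean P Y (fun ω => (Z ω, A ω, X ω)) t =
          ∫ w, h w t.2.1 t.2.2 ∂(condDistrib W (fun ω => (Z ω, A ω, X ω)) P t) := by
  have hC : Measurable fun ω => (A ω, X ω) := hA.prodMk hX
  have hker := ae_integral_condMean_mul_eq_zero hW hZ hU hA hX hY hYint
    (condIndepFun_prodMk_left_comm hA hU hX hZY) (condIndepFun_prodMk_left_comm hA hU hX hZW)
    hrel hYU
  obtain ⟨h, hh_meas, hh_sq, hh⟩ := exists_measurable_eq_integral_condDistrib hW hZ hC
    (stronglyMeasurable_condMean Y) (hreg.mono fun _ hc => hc.mean_sq)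
    (hreg.mp (hker.mono fun _ hc hreg_c => hreg_c.exists_condExpOp_ae_eq hc))
  exact ⟨fun w a x => h (w, a, x), hh_meas, hh_sq, hh⟩

theorem lemmaA2 {Ω 𝒲 𝒵 𝒰 𝒜 𝒳 : Type*}
    [MeasurableSpace Ω] [StandardBorelSpace Ω]
    [MeasurableSpace 𝒲] [StandardBorelSpace 𝒲] [Nonempty 𝒲]
    [MeasurableSpace 𝒵] [StandardBorelSpace 𝒵] [Nonempty 𝒵]
    [MeasurableSpace 𝒰] [StandardBorelSpace 𝒰] [Nonempty 𝒰]
    [MeasurableSpace 𝒜] [StandardBorelSpace 𝒜]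
    [MeasurableSpace 𝒳] [StandardBorelSpace 𝒳]
    (P : Measure Ω) [IsProbabilityMeasure P]
    (Y : Ω → ℝ) (W : Ω → 𝒲) (Z : Ω → 𝒵) (U : Ω → 𝒰) (A : Ω → 𝒜) (X : Ω → 𝒳)
    (hW : Measurable W) (hZ : Measurable Z) (hU : Measurable U)
    (hA : Measurable A) (hX : Measurable X)
    (hY : Measurable Y) (hYint : Integrable Y P)
    -- negative control exposure: Z ⫫ Y ∣ A, U, X and Z ⫫ W ∣ A, U, X
    (hZY : CondIndepFun (MeasurableSpace.comap (fun ω => (A ω, U ω, X ω)) inferInstance)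
      (hA.prodMk (hU.prodMk hX)).comap_le Z Y P)
    (hZW : CondIndepFun (MeasurableSpace.comap (fun ω => (A ω, U ω, X ω)) inferInstance)
      (hA.prodMk (hU.prodMk hX)).comap_le Z W P)
    -- relevance of W for U
    (hrel : ∀ᵐ c ∂(P.map fun ω => (A ω, X ω)), RelevantAt P W U A X c.1 c.2)
    -- regularity conditions
    (hreg : ∀ᵐ c ∂(P.map fun ω => (A ω, X ω)), RegularAt P Y W Z A X c.1 c.2)
    -- E(Y ∣ a, u, x) is square integrable for F(u ∣ a, x)
    (hYU : ∀ᵐ c ∂(P.map fun ω => (A ω, X ω)),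
      MemLp (fun u => condMean P Y (fun ω => (U ω, A ω, X ω)) (u, c.1, c.2)) 2
        (condDistrib U (fun ω => (A ω, X ω)) P c)) :
    ∃ h : 𝒲 → 𝒜 → 𝒳 → ℝ,
      Measurable (fun q : 𝒲 × 𝒜 × 𝒳 => h q.1 q.2.1 q.2.2) ∧
      (∀ᵐ c ∂(P.map fun ω => (A ω, X ω)),
        MemLp (fun w => h w c.1 c.2) 2 (condDistrib W (fun ω => (A ω, X ω)) P c)) ∧
      ∀ᵐ t ∂(P.map fun ω => (Z ω, A ω, X ω)),
        Integrable (fun w => h w t.2.1 t.2.2)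
          (condDistrib W (fun ω => (Z ω, A ω, X ω)) P t) ∧
        condMean P Y (fun ω => (Z ω, A ω, X ω)) t =
          ∫ w, h w t.2.1 t.2.2 ∂(condDistrib W (fun ω => (Z ω, A ω, X ω)) P t) :=
  lemmaA2_general P Y W Z U A X hW hZ hU hA hX hY hYint hZY hZW hrel hreg hYU
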